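/- **Setting.** Let $D\subset\mathbb{R}^d$ be open and let $S\subset\partial D$ be closed (the singular set of $D$), of Hausdorff dimension $\delta\in\mathbb{N}_0$. Assume that this dimension is attained at an edge of $D$: there are a point $x_0\in S$ and smooth local coordinates centred at $x_0$ in which $S$ is a $\delta$-dimensional linear subspace $V$ and $D$ is a nonempty open cone that is invariant under translations along $V$. (Examples: $D=\mathbb{R}^d\setminus\mathbb{R}^\delta$ with $S=\mathbb{R}^\delta$, $0\le\delta<d$; a polytope with its vertices, edges, …, $(d-2)$-faces, where $\delta=d-2$; $\mathbb{R}^d\setminus S$ for the singular set $S$ of a polytope.) Let $\rho:D\to(0,1]$ be smooth and equivalent to $\operatorname{dist}(\cdot,S)$ in a neighbourhood $\{x\in D:\operatorname{dist}(x,S)<\varepsilon\}$ of the singular set. For $m\in\mathbb{N}$, $a\in\mathbb{R}$, $1<p<\infty$, let $\mathcal{K}^m_{a,p}(D)$ be the Kondratiev space of all $u:D\to\mathbb{C}$ that have weak derivatives up to order $m$ in $D$ and a finite norm $$\|u|\mathcal{K}^m_{a,p}(D)\|=\Bigl(\sum_{|\alpha|\le m}\int_D|\rho(x)^{|\alpha|-a}\partial^\alpha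 u(x)|^p\,dx\Bigr)^{1/p}.$$ Let $\varphi_0\in\mathcal{S}(\mathbb{R}^d)$ with $\varphi_0(x)=1$ for $|x|\le1$ and $\varphi_0(x)=0$ for $|x|\ge\frac32$, let $\varphi_j=\varphi_0(2^{-j}\cdot)-\varphi_0(2^{-j+1}\cdot)$ for $j\ge1$, and $$\|f|F^s_{\tau,q}(\mathbb{R}^d)\|=\Bigl\|\Bigl(\sum_{j\ge0}2^{jsq}|\mathcal{F}^{-1}(\varphi_j\mathcal{F}f)|^q\Bigr)^{1/q}\Big|L_\tau(\mathbb{R}^d)\Bigr\|.$$ For dyadic cubes $Q_{j,k}=2^{-j}((0,1)^d+k)$, $j\ge0$, $k\in\mathbb{Z}^d$, let $2Q_{j,k}$ be the concentric open cube of twice the side length. Let $\{Q_{j,k}\}_{(j,k)\in W}$ be a Whitney decomposition of $D$: pairwise disjoint cubes such that $D$ is the union of their closures, $\operatorname{dist}(2Q_{j,k},\partial D)\sim2^{-j}$ for $j\ge1$, and $\operatorname{dist}(2Q_{0,k},\partial D)\ge c>0$. Let $\psi_{j,k}\ge0$, $(j,k)\in W$, be $C^\infty$ functions with $\operatorname{supp}\psi_{j,k}\subset2Q_{j,k}$,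 $\sum_{(j,k)\in W}\psi_{j,k}=1$ on $D$, and $|\partial^\alpha\psi_{j,k}|\le c_\alpha2^{j|\alpha|}$ for all $\alpha$. The refined localization space $F^{m,\mathrm{rloc}}_{\tau,2}(D)$ consists of all locally integrable $f$ on $D$ with $$\|f|F^{m,\mathrm{rloc}}_{\tau,2}(D)\|=\Bigl(\sum_{(j,k)\in W}\|\psi_{j,k}f|F^m_{\tau,2}(\mathbb{R}^d)\|^\tau\Bigr)^{1/\tau}<\infty.$$ **Proposition.** Let $m\in\mathbb{N}$, $m\ge1$, $a\in\mathbb{R}$, $1<p<\infty$, $0<\tau<p$, and let either $$m-a=(d-\delta)\Bigl(\frac1\tau-\frac1p\Bigr)\ \text{ and }\ a<m,\qquad\text{or}\qquad m-a>(d-\delta)\Bigl(\frac1\tau-\frac1p\Bigr).$$ Then there is a function $u\in\mathcal{K}^m_{a,p}(D)$ with $\|\rho^{-m}u|L_\tau(D)\|=\infty$. Moreover, for all choices of the Whitney decomposition $W$, of the resolution of unity $(\psi_{j,k})$ and of $\varphi_0$, the space $\mathcal{K}^m_{a,p}(D)$ is not continuously embedded into $F^{m,\mathrm{rloc}}_{\tau,2}(D)$,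 i.e., there is no constant $C<\infty$ such that every $u\in\mathcal{K}^m_{a,p}(D)$ belongs to $F^{m,\mathrm{rloc}}_{\tau,2}(D)$ with $\|u|F^{m,\mathrm{rloc}}_{\tau,2}(D)\|\le C\|u|\mathcal{K}^m_{a,p}(D)\|$. -/

import Mathlib

open MeasureTheory Set
open scoped ENNReal NNReal ContDiff FourierTransform SchwartzMap

noncomputable section

/-- `ℝ^d` with the Euclidean norm. -/
abbrev Eucl (d : ℕ) : Type := EuclideanSpace ℝ (Fin d)

/-! ### Domains and their singular sets -/

/-- `x` is a point of a `δ`-dimensional edge of `D`, and `S` is that edge near `x`: in smooth local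
coordinates centred at `x`, the set `S` is a `δ`-dimensional linear subspace `V`, and `D` is an open
cone which is invariant under translations along `V` (that is, the product of `V` with an open cone
in a complement of `V`). Examples: the complement of a `δ`-dimensional subspace, and a polytope near
a point in the relative interior of a face of the largest dimension in its singular set. -/
def IsEdgePoint {d : ℕ} (D S : Set (Eucl d)) (δ : ℕ) (x : Eucl d) : Prop :=
  ∃ (V : Submodule ℝ (Eucl d)) (K : Set (Eucl d)) (Φ : OpenPartialHomeomorph (Eucl d) (Eucl d)),
    Module.finrank ℝ V = δ ∧
    IsOpen K ∧ K.Nonempty ∧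
    (∀ t : ℝ, 0 < t → ∀ y ∈ K, t • y ∈ K) ∧
    (∀ v ∈ V, ∀ y ∈ K, y + v ∈ K) ∧
    ContDiffOn ℝ ∞ Φ Φ.source ∧ ContDiffOn ℝ ∞ Φ.symm Φ.target ∧
    x ∈ Φ.source ∧ Φ x = 0 ∧
    ∀ y ∈ Φ.source, (y ∈ S ↔ Φ y ∈ V) ∧ (y ∈ D ↔ Φ y ∈ K)

/-- `D` is a domain (open set) with closed singular set `S ⊆ ∂D` of dimension `δ`, where the
dimension is the Hausdorff dimension and is attained at an edge of `D`. -/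
structure IsDomainWithSingularSet {d : ℕ} (D S : Set (Eucl d)) (δ : ℕ) : Prop where
  isOpen : IsOpen D
  isClosed : IsClosed S
  subset_frontier : S ⊆ frontier D
  dimH_eq : dimH S = (δ : ℝ≥0∞)
  exists_edge : ∃ x, IsEdgePoint D S δ x

/-- `ρ` is a smooth function on `D` with values in `(0, 1]` which near the singular set `S` is
equivalent to the distance to `S`. -/
structure IsSmoothDistance {d : ℕ} (D S : Set (Eucl d)) (ρ : Eucl d → ℝ) : Prop where
  contDiffOn : ContDiffOn ℝ ∞ ρ D
  pos : ∀ x ∈ D, 0 < ρ x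
  le_one : ∀ x ∈ D, ρ x ≤ 1
  equiv : ∃ ε c C : ℝ, 0 < ε ∧ 0 < c ∧ 0 < C ∧ ∀ x ∈ D, Metric.infDist x S < ε →
    c * Metric.infDist x S ≤ ρ x ∧ ρ x ≤ C * Metric.infDist x S

/-! ### Partial derivatives and weak derivatives -/

/-- The list of coordinate directions of the multi-index `α`, in which `i` occurs `α i` times. -/
def directions {d : ℕ} (α : Fin d → ℕ) : List (Fin d) :=
  (List.finRange d).flatMap fun i => List.replicate (α i) i

/-- The classical partial derivative `∂^α f`. -/
def partialDeriv {d : ℕ} (α : Fin d → ℕ) (f : Eucl d → ℝ) (x : Eucl d) : ℝ :=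
  iteratedFDeriv ℝ (directions α).length f x
    fun i => EuclideanSpace.single ((directions α).get i) (1 : ℝ)

/-- `g` is the weak derivative `∂^α u` in the open set `D`. -/
def HasWeakDeriv {d : ℕ} (D : Set (Eucl d)) (α : Fin d → ℕ) (u g : Eucl d → ℂ) : Prop :=
  LocallyIntegrableOn u D ∧ LocallyIntegrableOn g D ∧
  ∀ θ : Eucl d → ℝ, ContDiff ℝ ∞ θ → HasCompactSupport θ → tsupport θ ⊆ D →
    ∫ x in D, partialDeriv α θ x • u x = (-1 : ℝ) ^ (∑ i, α i) • ∫ x in D, θ x • g x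

/-! ### Kondratiev spaces -/

/-- The norm of `u` in `𝒦^m_{a,p}(D)`. Weak derivatives are unique up to null sets, so the infimum
is over one value; it is `∞` if one of the weak derivatives of order at most `m` does not exist. -/
def kondratievNorm {d : ℕ} (D : Set (Eucl d)) (ρ : Eucl d → ℝ) (m : ℕ) (a p : ℝ)
    (u : Eucl d → ℂ) : ℝ≥0∞ :=
  ⨅ (g : (Fin d → ℕ) → Eucl d → ℂ) (_ : ∀ α, ∑ i, α i ≤ m → HasWeakDeriv D α u (g α)),
    (∑ k ∈ Finset.range (m + 1), ∑ α ∈ Finset.piAntidiag (Finset.univ : Finset (Fin d)) k,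
      ∫⁻ x in D, ‖ρ x ^ ((k : ℝ) - a) • g α x‖ₑ ^ p) ^ (1 / p)

/-- `u ∈ 𝒦^m_{a,p}(D)`. -/
def MemKondratiev {d : ℕ} (D : Set (Eucl d)) (ρ : Eucl d → ℝ) (m : ℕ) (a p : ℝ)
    (u : Eucl d → ℂ) : Prop :=
  kondratievNorm D ρ m a p u < ⊤

/-! ### Triebel-Lizorkin quasi-norms -/

/-- `φ₀` generates a smooth dyadic resolution of unity on `ℝ^d`. -/
def IsDyadicGenerator {d : ℕ} (φ₀ : 𝓢(Eucl d, ℂ)) : Prop :=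
  (∀ ξ, ‖ξ‖ ≤ 1 → φ₀ ξ = 1) ∧ ∀ ξ, 3 / 2 ≤ ‖ξ‖ → φ₀ ξ = 0

/-- The dyadic resolution of unity `φ_j` with `φ_0 = φ₀` and
`φ_j(ξ) = φ₀(2^{-j} ξ) - φ₀(2^{-j+1} ξ)` for `j ≥ 1`. -/
def dyadicFun {d : ℕ} (φ₀ : 𝓢(Eucl d, ℂ)) : ℕ → Eucl d → ℂ
  | 0, ξ => φ₀ ξ
  | j + 1, ξ => φ₀ (((2 : ℝ) ^ (j + 1))⁻¹ • ξ) - φ₀ (((2 : ℝ) ^ j)⁻¹ • ξ)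

/-- The Littlewood-Paley block `ℱ⁻¹(φ_j ℱ g)` of an integrable function `g`. -/
def lpBlock {d : ℕ} (φ₀ : 𝓢(Eucl d, ℂ)) (j : ℕ) (g : Eucl d → ℂ) : Eucl d → ℂ :=
  𝓕⁻ fun ξ => dyadicFun φ₀ j ξ * 𝓕 g ξ

/-- The quasi-norm of an integrable function `g` in `F^s_{p,q}(ℝ^d)`, for `0 < p, q < ∞`. -/
def triebelLizorkinNorm {d : ℕ} (φ₀ : 𝓢(Eucl d, ℂ)) (s p q : ℝ) (g : Eucl d → ℂ) : ℝ≥0∞ :=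
  (∫⁻ x, (∑' j : ℕ, (ENNReal.ofReal ((2 : ℝ) ^ ((j : ℝ) * s)) * ‖lpBlock φ₀ j g x‖ₑ) ^ q)
    ^ (p / q)) ^ (1 / p)

/-! ### Refined localization spaces -/

/-- The open dyadic cube `Q_{j,k} = 2^{-j}((0,1)^d + k)`; the index is `i = (j, k)`. -/
def dyadicCube {d : ℕ} (i : ℕ × (Fin d → ℤ)) : Set (Eucl d) :=
  {x | ∀ n, ((2 : ℝ) ^ i.1)⁻¹ * i.2 n < x n ∧ x n < ((2 : ℝ) ^ i.1)⁻¹ * (i.2 n + 1)}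

/-- The open cube `2 Q_{j,k}`, concentric with `Q_{j,k}` and of twice its side length. -/
def doubleCube {d : ℕ} (i : ℕ × (Fin d → ℤ)) : Set (Eucl d) :=
  {x | ∀ n, |x n - ((2 : ℝ) ^ i.1)⁻¹ * (i.2 n + 1 / 2)| < ((2 : ℝ) ^ i.1)⁻¹}

/-- The cubes `Q_{j,k}`, `(j, k) ∈ W`, are a Whitney decomposition of `D`: they are pairwise
disjoint, `D` is the union of their closures, `dist(2Q_{j,k}, ∂D) ∼ 2^{-j}` for `j ≥ 1`, and
`dist(2Q_{0,k}, ∂D)` is bounded from below. -/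
structure IsWhitneyDecomposition {d : ℕ} (D : Set (Eucl d)) (W : Set (ℕ × (Fin d → ℤ))) :
    Prop where
  pairwiseDisjoint : W.PairwiseDisjoint dyadicCube
  union_eq : ⋃ i ∈ W, closure (dyadicCube i) = D
  lower : ∃ c : ℝ, 0 < c ∧ ∀ i ∈ W, ∀ x ∈ doubleCube i,
    c * ((2 : ℝ) ^ i.1)⁻¹ ≤ Metric.infDist x (frontier D)
  upper : ∃ C : ℝ, 0 < C ∧ ∀ i ∈ W, 1 ≤ i.1 → ∃ x ∈ doubleCube i,
    Metric.infDist x (frontier D) ≤ C * ((2 : ℝ) ^ i.1)⁻¹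

/-- `ψ` is a resolution of unity on `D` with respect to the cubes of `W`. -/
structure IsResolutionOfUnity {d : ℕ} (D : Set (Eucl d)) (W : Set (ℕ × (Fin d → ℤ)))
    (ψ : ℕ × (Fin d → ℤ) → Eucl d → ℝ) : Prop where
  nonneg : ∀ i ∈ W, ∀ x, 0 ≤ ψ i x
  contDiff : ∀ i ∈ W, ContDiff ℝ ∞ (ψ i)
  tsupport_subset : ∀ i ∈ W, tsupport (ψ i) ⊆ doubleCube i
  hasSum_one : ∀ x ∈ D, HasSum (fun i : W => ψ i x) 1
  deriv_le : ∀ α : Fin d → ℕ, ∃ c : ℝ, ∀ i ∈ W, ∀ x,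
    |partialDeriv α (ψ i) x| ≤ c * (2 : ℝ) ^ (i.1 * ∑ n, α n)

/-- The quasi-norm in `F^{s,rloc}_{p,q}(D)` given by the Whitney decomposition `W`, the resolution
of unity `ψ` and the dyadic resolution generated by `φ₀`. The usual restriction
`s > d (1 / min(1, p, q) - 1)` is not imposed, as the formula makes sense without it. -/
def rlocNorm {d : ℕ} (W : Set (ℕ × (Fin d → ℤ))) (ψ : ℕ × (Fin d → ℤ) → Eucl d → ℝ)
    (φ₀ : 𝓢(Eucl d, ℂ)) (s p q : ℝ) (f : Eucl d → ℂ) : ℝ≥0∞ :=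
  (∑' i : W, triebelLizorkinNorm φ₀ s p q (fun x => ψ i x • f x) ^ p) ^ (1 / p)

/-- `f ∈ F^{s,rloc}_{p,q}(D)`. -/
def MemRloc {d : ℕ} (D : Set (Eucl d)) (W : Set (ℕ × (Fin d → ℤ)))
    (ψ : ℕ × (Fin d → ℤ) → Eucl d → ℝ) (φ₀ : 𝓢(Eucl d, ℂ)) (s p q : ℝ) (f : Eucl d → ℂ) : Prop :=
  LocallyIntegrableOn f D ∧ rlocNorm W ψ φ₀ s p q f < ⊤

/-- The continuous embedding `𝒦^m_{a,p}(D) ↪ F^{m,rloc}_{τ,2}(D)`. -/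
def KondratievEmbedsRloc {d : ℕ} (D : Set (Eucl d)) (ρ : Eucl d → ℝ) (m : ℕ) (a p τ : ℝ)
    (W : Set (ℕ × (Fin d → ℤ))) (ψ : ℕ × (Fin d → ℤ) → Eucl d → ℝ) (φ₀ : 𝓢(Eucl d, ℂ)) : Prop :=
  ∃ C : ℝ≥0, ∀ u : Eucl d → ℂ, MemKondratiev D ρ m a p u →
    MemRloc D W ψ φ₀ m τ 2 u ∧ rlocNorm W ψ φ₀ m τ 2 u ≤ C * kondratievNorm D ρ m a p u

end

/-! The obstruction is a count of dimensions along the edge. At scale `r = κ R⁻ⁿ` the edge has room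
for `R^(nδ)` points whose distances to `S` and to the frontier of `D` are comparable to `r`. Let `u`
be a sum of smooth bumps of width comparable to `r` and height `A`, one at each of these points,
over all generations `n`. In the Kondratiev norm a derivative of order `k` costs `r^(-k)` and the
weight gains `r^(k-a)`, so every order contributes at most a constant times `A^p r^(d-ap)` per bump.
In `‖ρ^(-m) u | L_τ‖` each bump contributes at least a constant times `A^τ r^(d-mτ)`.

Take `A = r^σ (n+1)^(-1/τ)` with `σ = a - (d-δ)/p`. Then `A^p r^(d-ap) = r^δ (n+1)^(-p/τ)`. Since
the `R^(nδ)` factors `r^δ` of one generation add up to the constant `κ^δ`, the Kondratiev series is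
`∑ (n+1)^(-p/τ)`, which converges as `τ < p`. The condition `(d-δ)(1/τ-1/p) ≤ m-a`, common to both
alternatives, says exactly that `στ + d - mτ ≤ δ`. Because `r ≤ 1`, the second series dominates the
harmonic series and diverges (`tsum_edgeAmplitude_ne_top`, `tsum_edgeAmplitude_eq_top`).

For the refined localization space the same growth `A r^(-m)` is found pointwise in the square
functions. At a point in the core of a bump, bounded overlap of the Whitney cubes provides a cube of
level `j`, with `2^(-j)` comparable to `r`, on which `ψ_{j,k} u` is at least a fixed fraction of
`A`. If the bumps are narrow relative to `r`, the part of this piece at frequencies up to `2^j` is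
smaller than half of that, by the crude bound `2^(jd) ‖φ₀‖₁ ‖ψ_{j,k} u‖₁` (`norm_lowFreq_le`). The
remaining part is controlled by the square function with the factor `2^(jm)`, through a geometric
series (`enorm_sub_lowFreq_le`). This argument is pointwise and works for every `τ > 0`. The points
are spread so far apart that each doubled Whitney cube sees only one bump. -/

noncomputable section

/-! ### Separated families of points along an edge -/

/-- Points `x b` of `D` and radii `r b` comparable to the distances of `x b` to `S` and to the
frontier of `D`; the points are separated on the scale of the radii, with a factor `B`. -/
structure IsSeparatedFamily {d : ℕ} {ι : Type*} (D S : Set (Eucl d)) (x : ι → Eucl d) (r : ι → ℝ)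
    (c C B r₀ : ℝ) : Prop where
  pos : ∀ b, 0 < r b
  le : ∀ b, r b ≤ r₀
  ball_subset : ∀ b, Metric.ball (x b) (c * r b) ⊆ D
  infDist_le : ∀ b, Metric.infDist (x b) S ≤ C * r b
  le_dist : ∀ b b', b ≠ b' → 2 * c * r b ≤ dist (x b) (x b')
  lt_dist : ∀ b b', b ≠ b' → B * min (r b) (r b') < dist (x b) (x b')
  finite : ∀ t : ℝ, 0 < t → {b | t ≤ r b}.Finite

/-- The indices of the points in generation `n` along an edge of dimension `δ`. -/
abbrev EdgeIndex (δ R : ℕ) : Type := Σ n : ℕ, (Fin δ → Fin (R ^ n))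

/-- The radius of the points in generation `n`. -/
def edgeRadius {δ R : ℕ} (κ : ℝ) (b : EdgeIndex δ R) : ℝ := κ * ((R : ℝ) ^ b.1)⁻¹

/-- Integer coordinates in an orthonormal basis of `V`: distinct vectors differ by at least `1` in
some coordinate. Rescaled by a multiple of `R⁻ⁿ`, they give the grid of `R^(nδ)` points of
generation `n`. -/
theorem exists_integer_vectors {d δ : ℕ} (V : Submodule ℝ (Eucl d)) (hV : Module.finrank ℝ V = δ) :
    ∃ v : (Fin δ → ℕ) → V, (∀ k (N : ℕ), (∀ i, k i ≤ N) → ‖v k‖ ≤ δ * N) ∧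
      ∀ k k', k ≠ k' → 1 ≤ ‖v k - v k'‖ := by
  let e := (stdOrthonormalBasis ℝ V).reindex (finCongr hV)
  refine ⟨fun k => e.repr.symm (WithLp.toLp 2 fun i => (k i : ℝ)), ?_, ?_⟩
  · intro k N hk
    beta_reduce
    rw [← e.sum_repr_symm]
    refine (norm_sum_le _ _).trans ?_
    calc _ ≤ ∑ i : Fin δ, (N : ℝ) := by
          refine Finset.sum_le_sum fun i _ => ?_
          rw [norm_smul, e.norm_eq_one, mul_one]
          simpa using hk i
      _ = δ * N := by simp
  · intro k k' hk
    obtain ⟨i, hi⟩ := Function.ne_iff.1 hk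
    rw [← map_sub, LinearIsometryEquiv.norm_map]
    refine le_trans ?_ (PiLp.norm_apply_le _ i)
    have : (1 : ℤ) ≤ |(k i : ℤ) - k' i| := by
      apply Int.one_le_abs; omega
    have h2 : (1 : ℝ) ≤ |(k i : ℝ) - k' i| := by exact_mod_cast this
    simpa using h2

theorem exists_lipschitz_chart {d : ℕ} (Φ : OpenPartialHomeomorph (Eucl d) (Eucl d))
    (h1 : ContDiffOn ℝ ∞ Φ Φ.source) (h2 : ContDiffOn ℝ ∞ Φ.symm Φ.target) {x : Eucl d}
    (hx : x ∈ Φ.source) (hx0 : Φ x = 0) :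
    ∃ L s : ℝ, 0 < L ∧ 0 < s ∧ Metric.ball x s ⊆ Φ.source ∧ Metric.ball 0 s ⊆ Φ.target ∧
      (∀ y ∈ Metric.ball x s, ∀ z ∈ Metric.ball x s, dist (Φ y) (Φ z) ≤ L * dist y z) ∧
      (∀ y ∈ Metric.ball 0 s, ∀ z ∈ Metric.ball 0 s,
        dist (Φ.symm y) (Φ.symm z) ≤ L * dist y z) := by
  have h0 : (0 : Eucl d) ∈ Φ.target := hx0 ▸ Φ.map_source hx
  have hc1 : ContDiffAt ℝ 1 Φ x :=
    (h1.contDiffAt (Φ.open_source.mem_nhds hx)).of_le (by norm_cast)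
  have hc2 : ContDiffAt ℝ 1 Φ.symm 0 :=
    (h2.contDiffAt (Φ.open_target.mem_nhds h0)).of_le (by norm_cast)
  obtain ⟨K1, t1, ht1, hK1⟩ := hc1.exists_lipschitzOnWith
  obtain ⟨K2, t2, ht2, hK2⟩ := hc2.exists_lipschitzOnWith
  obtain ⟨s1, hs1, hb1⟩ := Metric.mem_nhds_iff.1
    (Filter.inter_mem ht1 (Φ.open_source.mem_nhds hx))
  obtain ⟨s2, hs2, hb2⟩ := Metric.mem_nhds_iff.1
    (Filter.inter_mem ht2 (Φ.open_target.mem_nhds h0))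
  have hm1 : Metric.ball x (min s1 s2) ⊆ Metric.ball x s1 :=
    Metric.ball_subset_ball (min_le_left _ _)
  have hm2 : Metric.ball (0 : Eucl d) (min s1 s2) ⊆ Metric.ball 0 s2 :=
    Metric.ball_subset_ball (min_le_right _ _)
  refine ⟨K1 + K2 + 1, min s1 s2, by positivity, lt_min hs1 hs2,
    fun y hy => (hb1 (hm1 hy)).2, fun y hy => (hb2 (hm2 hy)).2, ?_, ?_⟩
  · intro y hy z hz
    refine (hK1.dist_le_mul y (hb1 (hm1 hy)).1 z (hb1 (hm1 hz)).1).trans ?_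
    gcongr
    linarith [K2.coe_nonneg]
  · intro y hy z hz
    refine (hK2.dist_le_mul y (hb2 (hm2 hy)).1 z (hb2 (hm2 hz)).1).trans ?_
    gcongr
    linarith [K1.coe_nonneg]

theorem edgeRadius_pos {δ R : ℕ} {κ : ℝ} (hκ : 0 < κ) (hR : 2 ≤ R) (b : EdgeIndex δ R) :
    0 < edgeRadius κ b := by
  unfold edgeRadius; positivity

theorem edgeRadius_le {δ R : ℕ} {κ : ℝ} (hκ : 0 < κ) (hR : 2 ≤ R) (b : EdgeIndex δ R) :
    edgeRadius κ b ≤ κ := by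
  have h1 : (1 : ℝ) ≤ (R : ℝ) ^ b.1 := one_le_pow₀ (by exact_mod_cast (by omega : 1 ≤ R))
  exact mul_le_of_le_one_right hκ.le (inv_le_one_of_one_le₀ h1)

theorem mul_edgeRadius_le {δ R : ℕ} {κ : ℝ} (hκ : 0 < κ) (hR : 2 ≤ R) {b b' : EdgeIndex δ R}
    (h : b.1 < b'.1) : R * edgeRadius κ b' ≤ edgeRadius κ b := by
  unfold edgeRadius
  have hR0 : (0 : ℝ) < R := by positivity
  have h1 : (1 : ℝ) ≤ R := by exact_mod_cast (by omega : 1 ≤ R)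
  have h2 : (R : ℝ) ^ (b.1 + 1) ≤ (R : ℝ) ^ b'.1 := pow_le_pow_right₀ h1 h
  calc R * (κ * ((R : ℝ) ^ b'.1)⁻¹) ≤ R * (κ * ((R : ℝ) ^ (b.1 + 1))⁻¹) := by gcongr
    _ = _ := by field_simp; ring

theorem finite_edgeRadius_ge {δ R : ℕ} {κ : ℝ} (hκ : 0 < κ) (hR : 2 ≤ R) {t : ℝ} (ht : 0 < t) :
    {b : EdgeIndex δ R | t ≤ edgeRadius κ b}.Finite := by
  obtain ⟨N, hN⟩ := exists_pow_lt_of_lt_one (div_pos ht hκ) (by norm_num : (1 / 2 : ℝ) < 1)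
  refine ((Finset.range N).sigma fun n =>
    (Finset.univ : Finset (Fin δ → Fin (R ^ n)))).finite_toSet.subset ?_
  intro b hb
  simp only [mem_ofPred_eq] at hb
  simp only [Finset.coe_sigma, Finset.coe_range, Finset.coe_univ, mem_sigma_iff, mem_Iio, mem_univ,
    and_true]
  by_contra! hlt
  have h2 : (2 : ℝ) ^ N ≤ (R : ℝ) ^ b.1 :=
    (pow_le_pow_right₀ (by norm_num) hlt).trans
      (pow_le_pow_left₀ (by norm_num) (by exact_mod_cast hR) _)
  have : edgeRadius κ b ≤ κ * ((2 : ℝ) ^ N)⁻¹ := by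
    unfold edgeRadius; gcongr
  rw [div_pow, one_pow, one_div, lt_div_iff₀ hκ] at hN
  linarith [mul_comm κ ((2 : ℝ) ^ N)⁻¹]

/-- In the chart the points are `r • y₀ + w` with `y₀` in the cone and `w` in a grid in `V`.
Dilations and translations along `V` carry a ball about `y₀` to balls of radius proportional to `r`
inside `K`, while `w` itself lies in `V` at distance `r ‖y₀‖`. Points of one generation are
separated by the grid; points of different generations by their components transversal to `V`. The
constants `c` and `C` come before `B` and `r₀`, since the later choice of `B` depends on them. -/
theorem exists_isSeparatedFamily {d δ : ℕ} {D S : Set (Eucl d)}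
    (hD : IsDomainWithSingularSet D S δ) :
    ∃ c C : ℝ, 0 < c ∧ 0 < C ∧ ∀ B r₀ : ℝ, 0 < B → 0 < r₀ → ∃ (κ : ℝ) (R : ℕ), 0 < κ ∧ 2 ≤ R ∧
      ∃ x : EdgeIndex δ R → Eucl d, IsSeparatedFamily D S x (edgeRadius κ) c C B r₀ := by
  obtain ⟨x₀, V, K, Φ, hV, hKo, ⟨y₀, hy₀⟩, hcone, htrans, hΦ, hΦs, hxs, hx0, hDS⟩ := hD.exists_edge
  obtain ⟨L, s, hL, hs, hsrc, htgt, hlip, hlips⟩ := exists_lipschitz_chart Φ hΦ hΦs hxs hx0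
  have h0K : (0 : Eucl d) ∉ K := by
    intro h0
    have hx₀S : x₀ ∈ S := (hDS x₀ hxs).1.2 (by rw [hx0]; exact V.zero_mem)
    have hx₀D : x₀ ∈ D := (hDS x₀ hxs).2.2 (by rwa [hx0])
    have := hD.subset_frontier hx₀S
    rw [hD.isOpen.frontier_eq] at this
    exact this.2 hx₀D
  have hy₀0 : 0 < ‖y₀‖ := norm_pos_iff.2 fun h => h0K (h ▸ hy₀)
  obtain ⟨h, hh, hball⟩ := Metric.isOpen_iff.1 hKo y₀ hy₀
  -- Otherwise `-w` is in the ball about `y₀`, hence in `K`, and translation by `w` puts `0` into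
  -- `K`.
  have hdistV : ∀ w ∈ V, h ≤ ‖y₀ + w‖ := by
    intro w hw
    by_contra! hlt
    have h1 : -w ∈ K := hball (by
      rw [Metric.mem_ball, dist_comm, dist_eq_norm]; simpa using hlt)
    exact h0K (by simpa using htrans w hw _ h1)
  obtain ⟨v, hv, hvsep⟩ := exists_integer_vectors V hV
  -- The chart maps the ball of radius `c r` into a ball of radius `r h / 4`, inside `K` with room
  -- to spare for the separation; the inverse chart turns the distance `r ‖y₀‖` to `V` into at most
  -- `L ‖y₀‖ r`.
  refine ⟨h / (4 * L), L * ‖y₀‖, by positivity, by positivity, ?_⟩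
  intro B r₀ hB hr₀
  set c := h / (4 * L) with hc
  have hc0 : 0 < c := by positivity
  have hLc : L * c = h / 4 := by rw [hc]; field_simp
  -- The second bound keeps the points within `s / 2` of `x₀`, so that the balls around them stay in
  -- the chart.
  set s' := min s (s / (2 * L)) with hs'
  have hs'0 : 0 < s' := by positivity
  -- Grid vectors have norm at most `σ δ`; the `+ 1` makes the bound strict and covers `δ = 0`.
  set σ := s' / (2 * (δ + 1)) with hσ
  have hσ0 : 0 < σ := by positivity
  have hσδ : σ * δ < s' / 2 := by
    rw [hσ, div_mul_eq_mul_div, div_lt_div_iff₀ (by positivity) (by positivity)]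
    nlinarith
  -- The last condition makes the grid spacing `σ R⁻ⁿ` beat the radius `κ R⁻ⁿ` by the factor
  -- required within a generation; the two before it keep the points and their balls inside the
  -- chart.
  obtain ⟨κ, hκ, hκ1, hκ2, hκ3, hκ4⟩ : ∃ κ : ℝ, 0 < κ ∧ κ ≤ r₀ ∧ κ * ‖y₀‖ ≤ s' / 2 ∧
      c * κ ≤ s / 2 ∧ L * (B + 2 * c) * κ < σ := by
    refine ⟨min (min r₀ (s' / 2 / ‖y₀‖)) (min (s / 2 / c) (σ / (2 * (L * (B + 2 * c))))),
      by positivity, (min_le_left _ _).trans (min_le_left _ _), ?_, ?_, ?_⟩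
    · rw [← le_div_iff₀ hy₀0]; exact (min_le_left _ _).trans (min_le_right _ _)
    · rw [← le_div_iff₀' hc0]; exact (min_le_right _ _).trans (min_le_left _ _)
    · rw [← lt_div_iff₀' (by positivity)]
      refine ((min_le_right _ _).trans (min_le_right _ _)).trans_lt ?_
      rw [div_lt_div_iff₀ (by positivity) (by positivity)]
      have : 0 < L * (B + 2 * c) := by positivity
      nlinarith
  -- Between generations the radii differ by at least `(R - 1) r'`, where `r'` is the smaller one,
  -- and this gap times `h` has to exceed `L B r'`.
  obtain ⟨R, hR⟩ := exists_nat_gt (max 2 (L * B / h + 1))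
  have hR2' : (2 : ℝ) < R := (le_max_left _ _).trans_lt hR
  have hR2 : 2 ≤ R := by exact_mod_cast hR2'.le
  have hRB : L * B < (R - 1) * h := by
    rw [← div_lt_iff₀ hh]; linarith [(le_max_right _ _).trans_lt hR]
  have hR0 : (0 : ℝ) < R := by linarith
  refine ⟨κ, R, hκ, hR2, ?_⟩
  let w : EdgeIndex δ R → Eucl d := fun b =>
    ((σ * ((R : ℝ) ^ b.1)⁻¹) • v (fun i => (b.2 i : ℕ)) : V)
  have hwV : ∀ b, w b ∈ V := fun b => Subtype.mem _
  let z : EdgeIndex δ R → Eucl d := fun b => edgeRadius κ b • y₀ + w b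
  have hrpos := fun b : EdgeIndex δ R => edgeRadius_pos hκ hR2 b
  have hrle := fun b : EdgeIndex δ R => edgeRadius_le hκ hR2 b
  have hwn : ∀ b, ‖w b‖ < s' / 2 := by
    intro b
    have hRn : (0 : ℝ) < (R : ℝ) ^ b.1 := by positivity
    have h1 := hv (fun i => (b.2 i : ℕ)) (R ^ b.1) (fun i => (b.2 i).2.le)
    have h2 : ‖w b‖ = (σ * ((R : ℝ) ^ b.1)⁻¹) * ‖v (fun i => (b.2 i : ℕ))‖ := by
      change ‖((σ * ((R : ℝ) ^ b.1)⁻¹) • v (fun i => (b.2 i : ℕ)) : V)‖ = _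
      rw [norm_smul, Real.norm_of_nonneg (by positivity)]
    rw [h2]
    calc _ ≤ (σ * ((R : ℝ) ^ b.1)⁻¹) * (δ * ((R ^ b.1 : ℕ) : ℝ)) := by gcongr
      _ = σ * δ := by push_cast; field_simp
      _ < _ := hσδ
  have hs's : s' ≤ s := min_le_left _ _
  have hwball : ∀ b, w b ∈ Metric.ball (0 : Eucl d) s' := by
    intro b; rw [mem_ball_zero_iff]; linarith [hwn b]
  have hzball : ∀ b, z b ∈ Metric.ball (0 : Eucl d) s' := by
    intro b
    rw [mem_ball_zero_iff]
    refine (norm_add_le _ _).trans_lt ?_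
    rw [norm_smul, Real.norm_of_nonneg (hrpos b).le]
    have : edgeRadius κ b * ‖y₀‖ ≤ κ * ‖y₀‖ := by gcongr; exact hrle b
    linarith [hwn b]
  have hsub : Metric.ball (0 : Eucl d) s' ⊆ Metric.ball 0 s := Metric.ball_subset_ball hs's
  have hΦx : ∀ b, Φ (Φ.symm (z b)) = z b := fun b => Φ.right_inv (htgt (hsub (hzball b)))
  have hxball : ∀ b, dist (Φ.symm (z b)) x₀ < s / 2 := by
    intro b
    have h1 : Φ.symm 0 = x₀ := by rw [← hx0]; exact Φ.left_inv hxs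
    have h2 := hlips _ (hsub (hzball b)) 0 (Metric.mem_ball_self hs)
    rw [h1] at h2
    have h3 : dist (z b) 0 < s / (2 * L) :=
      (Metric.mem_ball.1 (hzball b)).trans_le (min_le_right _ _)
    calc _ ≤ _ := h2
      _ < L * (s / (2 * L)) := by gcongr
      _ = s / 2 := by field_simp
  have hxball' : ∀ b, Φ.symm (z b) ∈ Metric.ball x₀ s := fun b => by
    rw [Metric.mem_ball]; linarith [hxball b]
  have hzx : ∀ b b', dist (z b) (z b') ≤ L * dist (Φ.symm (z b)) (Φ.symm (z b')) := by
    intro b b'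
    simpa only [hΦx] using hlip _ (hxball' b) _ (hxball' b')
  have hsep_lt : ∀ b b' : EdgeIndex δ R, b.1 < b'.1 →
      2 * c * edgeRadius κ b ≤ dist (Φ.symm (z b)) (Φ.symm (z b')) ∧
      2 * c * edgeRadius κ b' ≤ dist (Φ.symm (z b)) (Φ.symm (z b')) ∧
      B * edgeRadius κ b' < dist (Φ.symm (z b)) (Φ.symm (z b')) := by
    intro b b' hlt
    have hrr := mul_edgeRadius_le hκ hR2 hlt
    have hb := hrpos b
    have hb' := hrpos b'
    have hpos : 0 < edgeRadius κ b - edgeRadius κ b' := by nlinarith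
    have hz1 : (edgeRadius κ b - edgeRadius κ b') * h ≤ dist (z b) (z b') := by
      have : z b - z b' = (edgeRadius κ b - edgeRadius κ b') •
          (y₀ + (edgeRadius κ b - edgeRadius κ b')⁻¹ • (w b - w b')) := by
        rw [smul_add, smul_inv_smul₀ hpos.ne', sub_smul]
        simp only [z]; abel
      rw [dist_eq_norm, this, norm_smul, Real.norm_of_nonneg hpos.le]
      gcongr
      exact hdistV _ (V.smul_mem _ (V.sub_mem (hwV b) (hwV b')))
    have hz2 := hz1.trans (hzx b b')
    have e1 : 2 * c * edgeRadius κ b ≤ dist (Φ.symm (z b)) (Φ.symm (z b')) := by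
      rw [← mul_le_mul_iff_right₀ hL]
      refine le_trans ?_ hz2
      have : L * (2 * c * edgeRadius κ b) = edgeRadius κ b / 2 * h := by
        calc _ = 2 * (L * c) * edgeRadius κ b := by ring
          _ = _ := by rw [hLc]; ring
      rw [this]
      gcongr
      nlinarith
    refine ⟨e1, le_trans ?_ e1, ?_⟩
    · gcongr; linarith
    · rw [← mul_lt_mul_iff_right₀ hL]
      refine lt_of_lt_of_le ?_ hz2
      calc L * (B * edgeRadius κ b') = (L * B) * edgeRadius κ b' := by ring
        _ < (R - 1) * h * edgeRadius κ b' := by gcongr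
        _ = (R * edgeRadius κ b' - edgeRadius κ b') * h := by ring
        _ ≤ _ := by gcongr
  have hsep_eq : ∀ b b' : EdgeIndex δ R, b ≠ b' → b.1 = b'.1 →
      (B + 2 * c) * edgeRadius κ b < dist (Φ.symm (z b)) (Φ.symm (z b')) := by
    rintro ⟨n, k⟩ ⟨n', k'⟩ hne (rfl : n = n')
    have hkk : (fun i => (k i : ℕ)) ≠ fun i => (k' i : ℕ) := by
      intro heq
      apply hne
      congr 1
      funext i
      exact Fin.ext (congrFun heq i)
    have hRn : (0 : ℝ) < (R : ℝ) ^ n := by positivity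
    have h1 : σ * ((R : ℝ) ^ n)⁻¹ ≤ dist (z ⟨n, k⟩) (z ⟨n, k'⟩) := by
      have : z ⟨n, k⟩ - z ⟨n, k'⟩ = (((σ * ((R : ℝ) ^ n)⁻¹) •
          (v (fun i => (k i : ℕ)) - v (fun i => (k' i : ℕ))) : V) : Eucl d) := by
        simp only [z, w, edgeRadius, smul_sub, Submodule.coe_sub]; abel
      rw [dist_eq_norm, this, ← Submodule.coe_norm, norm_smul,
        Real.norm_of_nonneg (by positivity)]
      exact le_mul_of_one_le_right (by positivity) (hvsep _ _ hkk)
    rw [← mul_lt_mul_iff_right₀ hL]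
    refine lt_of_lt_of_le ?_ (h1.trans (hzx _ _))
    calc _ = L * (B + 2 * c) * κ * ((R : ℝ) ^ n)⁻¹ := by simp only [edgeRadius]; ring
      _ < _ := by gcongr
  refine ⟨fun b => Φ.symm (z b), hrpos, fun b => (hrle b).trans hκ1, ?_, ?_, ?_, ?_,
    fun t ht => finite_edgeRadius_ge hκ hR2 ht⟩
  · intro b y hy
    have hy' : dist y (Φ.symm (z b)) < c * edgeRadius κ b := hy
    have hcr : c * edgeRadius κ b ≤ s / 2 := le_trans (by gcongr; exact hrle b) hκ3
    have hys : y ∈ Metric.ball x₀ s := by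
      rw [Metric.mem_ball]
      linarith [dist_triangle y (Φ.symm (z b)) x₀, hxball b]
    rw [(hDS y (hsrc hys)).2]
    have h1 : dist (Φ y) (z b) < edgeRadius κ b * h := by
      have := hlip y hys _ (hxball' b)
      rw [hΦx] at this
      calc _ ≤ _ := this
        _ < L * (c * edgeRadius κ b) := by gcongr
        _ = edgeRadius κ b * (h / 4) := by rw [← hLc]; ring
        _ ≤ _ := by gcongr; linarith [hrpos b]; linarith
    have h2 : y₀ + (edgeRadius κ b)⁻¹ • (Φ y - z b) ∈ K := by
      apply hball
      rw [Metric.mem_ball, dist_eq_norm, add_sub_cancel_left, norm_smul, norm_inv,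
        Real.norm_of_nonneg (hrpos b).le, inv_mul_lt_iff₀ (hrpos b), ← dist_eq_norm]
      exact h1
    have h3 := htrans _ (hwV b) _ (hcone _ (hrpos b) _ h2)
    rw [smul_add, smul_inv_smul₀ (hrpos b).ne'] at h3
    convert h3 using 1
    simp only [z]; abel
  · intro b
    have hwS : Φ.symm (w b) ∈ S := by
      have := htgt (hsub (hwball b))
      rw [(hDS _ (Φ.map_target this)).1, Φ.right_inv this]
      exact hwV b
    refine (Metric.infDist_le_dist_of_mem hwS).trans
      ((hlips _ (hsub (hzball b)) _ (hsub (hwball b))).trans (le_of_eq ?_))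
    simp only [z]
    rw [dist_eq_norm, add_sub_cancel_right, norm_smul, Real.norm_of_nonneg (hrpos b).le]
    ring
  · intro b b' hne
    rcases lt_trichotomy b.1 b'.1 with hlt | heq | hgt
    · exact (hsep_lt b b' hlt).1
    · have := hsep_eq b b' hne heq
      have hb := hrpos b
      nlinarith [mul_pos hB hb]
    · rw [dist_comm]; exact (hsep_lt b' b hgt).2.1
  · intro b b' hne
    rcases lt_trichotomy b.1 b'.1 with hlt | heq | hgt
    · refine lt_of_le_of_lt ?_ (hsep_lt b b' hlt).2.2
      gcongr; exact min_le_right _ _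
    · have := hsep_eq b b' hne heq
      have hb := hrpos b
      have : B * min (edgeRadius κ b) (edgeRadius κ b') ≤ B * edgeRadius κ b := by
        gcongr; exact min_le_left _ _
      nlinarith [mul_pos hc0 hb]
    · rw [dist_comm]
      refine lt_of_le_of_lt ?_ (hsep_lt b' b hgt).2.2
      gcongr; exact min_le_left _ _

/-! ### Integration by parts for iterated derivatives -/

section IntegrationByParts

variable {E : Type*} [NormedAddCommGroup E] [NormedSpace ℝ E]

theorem ContDiff.fderiv_apply_const {f : E → ℝ} (hf : ContDiff ℝ ∞ f) (v : E) :
    ContDiff ℝ ∞ fun x => fderiv ℝ f x v :=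
  (hf.fderiv_right (m := ∞) (by norm_cast)).clm_apply contDiff_const

theorem ContDiff.iteratedFDeriv_apply_const {f : E → ℝ} (hf : ContDiff ℝ ∞ f) {n : ℕ}
    (v : Fin n → E) : ContDiff ℝ ∞ fun x => iteratedFDeriv ℝ n f x v :=
  (ContinuousMultilinearMap.apply ℝ (fun _ : Fin n => E) ℝ v).contDiff.comp
    (hf.iteratedFDeriv_right (m := ∞) (by norm_cast))

theorem fderiv_fderiv_apply_comm {f : E → ℝ} (hf : ContDiff ℝ ∞ f) (v w x : E) :
    fderiv ℝ (fun y => fderiv ℝ f y w) x v = fderiv ℝ (fun y => fderiv ℝ f y v) x w := by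
  have hd : DifferentiableAt ℝ (fderiv ℝ f) x :=
    (hf.fderiv_right (m := ∞) (by norm_cast)).differentiable (by simp) x
  have hsymm : IsSymmSndFDerivAt ℝ f x :=
    hf.contDiffAt.isSymmSndFDerivAt (by simp only [minSmoothness_of_isRCLikeNormedField]; norm_cast)
  rw [fderiv_clm_apply hd (differentiableAt_const _),
    fderiv_clm_apply hd (differentiableAt_const _)]
  simpa using hsymm.eq v w

theorem iteratedFDeriv_succ_apply_eq_fderiv {f : E → ℝ} (hf : ContDiff ℝ ∞ f) {n : ℕ}
    (v : Fin (n + 1) → E) (x : E) :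
    iteratedFDeriv ℝ (n + 1) f x v =
      fderiv ℝ (fun y => iteratedFDeriv ℝ n f y (Fin.tail v)) x (v 0) :=
  DifferentiableAt.iteratedFDeriv_succ_apply_left'
    ((hf.iteratedFDeriv_right (m := ∞) (by norm_cast)).differentiable (by simp) x)

theorem iteratedFDeriv_fderiv_apply_comm {f : E → ℝ} (hf : ContDiff ℝ ∞ f) {n : ℕ}
    (v : Fin n → E) (w x : E) :
    iteratedFDeriv ℝ n (fun y => fderiv ℝ f y w) x v =
      fderiv ℝ (fun y => iteratedFDeriv ℝ n f y v) x w := by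
  induction n generalizing x with
  | zero => simp
  | succ n ih =>
    rw [iteratedFDeriv_succ_apply_eq_fderiv (hf.fderiv_apply_const w)]
    simp_rw [ih, iteratedFDeriv_succ_apply_eq_fderiv hf]
    exact fderiv_fderiv_apply_comm (hf.iteratedFDeriv_apply_const _) _ _ _

theorem HasCompactSupport.iteratedFDeriv_apply_const {f : E → ℝ} (hf : HasCompactSupport f) {n : ℕ}
    (v : Fin n → E) : HasCompactSupport fun x => _root_.iteratedFDeriv ℝ n f x v :=
  (hf.iteratedFDeriv (𝕜 := ℝ) n).comp_left (g := fun M : E [×n]→L[ℝ] ℝ => M v) (by simp)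

theorem HasCompactSupport.fderiv_apply_const {f : E → ℝ} (hf : HasCompactSupport f)
    (v : E) : HasCompactSupport fun x => _root_.fderiv ℝ f x v :=
  (hf.fderiv (𝕜 := ℝ)).comp_left (g := fun M : E →L[ℝ] ℝ => M v) (by simp)

/-- The outermost derivative of `θ` is moved onto `f`, where it becomes the innermost one; symmetry
of second derivatives brings it back to the outside. Compact support of `θ` alone makes all products
integrable. -/
theorem integral_iteratedFDeriv_mul [FiniteDimensional ℝ E] [MeasurableSpace E] [BorelSpace E]
    (μ : Measure E) [μ.IsAddHaarMeasure] {θ f : E → ℝ} (hθ : ContDiff ℝ ∞ θ)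
    (hθc : HasCompactSupport θ) (hf : ContDiff ℝ ∞ f) {n : ℕ} (v : Fin n → E) :
    ∫ x, iteratedFDeriv ℝ n θ x v * f x ∂μ =
      (-1) ^ n * ∫ x, θ x * iteratedFDeriv ℝ n f x v ∂μ := by
  induction n generalizing f with
  | zero => simp
  | succ n ih =>
    have hθ' := hθ.iteratedFDeriv_apply_const (Fin.tail v)
    have hθc' := hθc.iteratedFDeriv_apply_const (Fin.tail v)
    have key := integral_mul_fderiv_eq_neg_fderiv_mul_of_integrable (μ := μ)
      (f := fun x => iteratedFDeriv ℝ n θ x (Fin.tail v)) (g := f) (v := v 0)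
      (((hθ'.fderiv_apply_const _).continuous.mul hf.continuous).integrable_of_hasCompactSupport
        (hθc'.fderiv_apply_const _).mul_right)
      ((hθ'.continuous.mul (hf.fderiv_apply_const _).continuous).integrable_of_hasCompactSupport
        hθc'.mul_right)
      ((hθ'.continuous.mul hf.continuous).integrable_of_hasCompactSupport hθc'.mul_right)
      (fun x _ => hθ'.differentiable (by simp) x) (fun x _ => hf.differentiable (by simp) x)
    simp_rw [iteratedFDeriv_succ_apply_eq_fderiv hθ]
    rw [← neg_eq_iff_eq_neg.2 key, ih (hf.fderiv_apply_const _)]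
    simp_rw [iteratedFDeriv_fderiv_apply_comm hf, iteratedFDeriv_succ_apply_eq_fderiv hf]
    ring

end IntegrationByParts

/-! ### Partial derivatives -/

theorem length_directions {d : ℕ} (α : Fin d → ℕ) : (directions α).length = ∑ i, α i := by
  simp [directions, List.length_flatMap, Fin.sum_univ_def]

theorem partialDeriv_zero {d : ℕ} (f : Eucl d → ℝ) : partialDeriv (0 : Fin d → ℕ) f = f := by
  have h : directions (0 : Fin d → ℕ) = [] := by simp [directions]
  funext x
  unfold partialDeriv
  rw [h]
  simp

theorem contDiff_partialDeriv {d : ℕ} (α : Fin d → ℕ) {f : Eucl d → ℝ} (hf : ContDiff ℝ ∞ f) :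
    ContDiff ℝ ∞ (partialDeriv α f) :=
  hf.iteratedFDeriv_apply_const _

theorem support_partialDeriv_subset {d : ℕ} (α : Fin d → ℕ) (f : Eucl d → ℝ) :
    Function.support (partialDeriv α f) ⊆ tsupport f := by
  intro x hx
  refine support_iteratedFDeriv_subset (𝕜 := ℝ) (directions α).length ?_
  intro h
  apply hx
  simp [partialDeriv, h]

theorem abs_partialDeriv_le {d : ℕ} (α : Fin d → ℕ) (f : Eucl d → ℝ) (x : Eucl d) :
    |partialDeriv α f x| ≤ ‖iteratedFDeriv ℝ (∑ i, α i) f x‖ := by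
  rw [← length_directions α]
  refine ((iteratedFDeriv ℝ (directions α).length f x).le_opNorm _).trans ?_
  simp

/-! ### Rescaled bump functions -/

/-- A bump function on the unit ball of `ℝ^d`, equal to `1` on the ball of radius `1 / 2`. -/
def unitBump (d : ℕ) : ContDiffBump (0 : Eucl d) := ⟨1 / 2, 1, by norm_num, by norm_num⟩

/-- The bump function on the ball with centre `y` and radius `s`. -/
def scaledBump {d : ℕ} (y : Eucl d) (s : ℝ) (x : Eucl d) : ℝ := unitBump d (s⁻¹ • (x - y))

theorem contDiff_scaledBump {d : ℕ} (y : Eucl d) (s : ℝ) : ContDiff ℝ ∞ (scaledBump y s) :=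
  (unitBump d).contDiff.comp (by fun_prop : ContDiff ℝ ∞ fun x => s⁻¹ • (x - y))

theorem scaledBump_nonneg {d : ℕ} (y : Eucl d) (s : ℝ) (x : Eucl d) : 0 ≤ scaledBump y s x :=
  (unitBump d).nonneg

theorem scaledBump_le_one {d : ℕ} (y : Eucl d) (s : ℝ) (x : Eucl d) : scaledBump y s x ≤ 1 :=
  (unitBump d).le_one

theorem scaledBump_eq_one {d : ℕ} {y : Eucl d} {s : ℝ} (hs : 0 < s) {x : Eucl d}
    (hx : x ∈ Metric.closedBall y (s / 2)) : scaledBump y s x = 1 := by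
  apply (unitBump d).one_of_mem_closedBall
  rw [mem_closedBall_zero_iff, norm_smul, norm_inv, Real.norm_of_nonneg hs.le, inv_mul_le_iff₀ hs]
  rw [Metric.mem_closedBall, dist_eq_norm] at hx
  change ‖x - y‖ ≤ s * (1 / 2)
  linarith

theorem tsupport_scaledBump_subset {d : ℕ} (y : Eucl d) {s : ℝ} (hs : 0 < s) :
    tsupport (scaledBump y s) ⊆ Metric.closedBall y s := by
  refine closure_minimal ?_ Metric.isClosed_closedBall
  intro x hx
  by_contra hlt
  rw [Metric.mem_closedBall, not_le, dist_eq_norm] at hlt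
  refine hx ((unitBump d).zero_of_le_dist ?_)
  rw [dist_zero_right, norm_smul, norm_inv, Real.norm_of_nonneg hs.le, le_inv_mul_iff₀ hs]
  change s * 1 ≤ _
  linarith

theorem hasCompactSupport_scaledBump {d : ℕ} (y : Eucl d) {s : ℝ} (hs : 0 < s) :
    HasCompactSupport (scaledBump y s) :=
  (isCompact_closedBall y s).of_isClosed_subset (isClosed_tsupport _)
    (tsupport_scaledBump_subset y hs)

theorem exists_abs_partialDeriv_scaledBump_le (d k : ℕ) :
    ∃ M : ℝ, 0 < M ∧ ∀ (y : Eucl d) (s : ℝ), 0 < s → ∀ α : Fin d → ℕ, ∑ i, α i = k → ∀ x,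
      |partialDeriv α (scaledBump y s) x| ≤ M * (s ^ k)⁻¹ := by
  have hsm : ContDiff ℝ ∞ (unitBump d : Eucl d → ℝ) := (unitBump d).contDiff
  have hcont : Continuous (iteratedFDeriv ℝ k (unitBump d : Eucl d → ℝ)) :=
    hsm.continuous_iteratedFDeriv (by norm_cast; exact le_top)
  obtain ⟨M, hM⟩ := hcont.bounded_above_of_compact_support
    ((unitBump d).hasCompactSupport.iteratedFDeriv k)
  refine ⟨max M 1, by positivity, fun y s hs α hα x => ?_⟩
  refine (abs_partialDeriv_le α _ x).trans ?_
  rw [hα]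
  have h1 : iteratedFDeriv ℝ k (scaledBump y s) x =
      (s⁻¹) ^ k • iteratedFDeriv ℝ k (unitBump d : Eucl d → ℝ) (s⁻¹ • (x - y)) := by
    have := iteratedFDeriv_comp_sub (𝕜 := ℝ) (f := fun z : Eucl d => unitBump d (s⁻¹ • z)) k y x
    change iteratedFDeriv ℝ k (fun z : Eucl d => unitBump d (s⁻¹ • (z - y))) x = _
    rw [this, iteratedFDeriv_comp_const_smul _ (hsm.of_le (by norm_cast; exact le_top))]
  rw [h1, norm_smul, norm_pow, norm_inv, Real.norm_of_nonneg hs.le, inv_pow, mul_comm]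
  gcongr
  exact (hM _).trans (le_max_left _ _)

/-! ### Integrals over disjoint families of sets -/

theorem tsum_mul_measure_le_lintegral {X ι : Type*} [MeasurableSpace X] [Countable ι]
    {μ : Measure X} {s : ι → Set X} (hs : ∀ b, MeasurableSet (s b))
    (hd : Pairwise (Function.onFun Disjoint s)) {L : ι → ℝ≥0∞} {h : X → ℝ≥0∞}
    (hL : ∀ b, ∀ x ∈ s b, L b ≤ h x) : ∑' b, L b * μ (s b) ≤ ∫⁻ x, h x ∂μ := by
  calc ∑' b, L b * μ (s b) ≤ ∑' b, ∫⁻ x in s b, h x ∂μ := by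
        refine ENNReal.tsum_le_tsum fun b => ?_
        rw [← setLIntegral_const]
        exact setLIntegral_mono' (hs b) (hL b)
    _ = ∫⁻ x in ⋃ b, s b, h x ∂μ := (lintegral_iUnion hs hd h).symm
    _ ≤ _ := setLIntegral_le_lintegral _ _

theorem lintegral_le_tsum_mul_measure {X ι : Type*} [MeasurableSpace X] [Countable ι]
    {μ : Measure X} {s : ι → Set X} (hs : ∀ b, MeasurableSet (s b)) {L : ι → ℝ≥0∞} {h : X → ℝ≥0∞}
    (hL : ∀ b, ∀ x ∈ s b, h x ≤ L b) (h0 : ∀ x, (∀ b, x ∉ s b) → h x = 0) :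
    ∫⁻ x, h x ∂μ ≤ ∑' b, L b * μ (s b) := by
  calc ∫⁻ x, h x ∂μ = ∫⁻ x in ⋃ b, s b, h x ∂μ := by
        rw [← lintegral_indicator (MeasurableSet.iUnion hs)]
        refine lintegral_congr fun x => ?_
        by_cases hx : x ∈ ⋃ b, s b
        · rw [indicator_of_mem hx]
        · rw [indicator_of_notMem hx, h0 x (by simpa using hx)]
    _ ≤ ∑' b, ∫⁻ x in s b, h x ∂μ := lintegral_iUnion_le _ _
    _ ≤ _ := by
        refine ENNReal.tsum_le_tsum fun b => ?_
        rw [← setLIntegral_const]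
        exact setLIntegral_mono' (hs b) (hL b)

/-! ### Sums of bumps over a separated family of balls -/

namespace IsSeparatedFamily

variable {d : ℕ} {ι : Type*} {D S : Set (Eucl d)} {x : ι → Eucl d} {r : ι → ℝ} {c C B r₀ : ℝ}

theorem eq_of_mem_closedBall (h : IsSeparatedFamily D S x r c C B r₀) (hc : 0 < c) {y : Eucl d}
    {b b' : ι} (hb : y ∈ Metric.closedBall (x b) (c / 2 * r b))
    (hb' : y ∈ Metric.closedBall (x b') (c / 2 * r b')) : b = b' := by
  by_contra hne
  have h1 := h.le_dist b b' hne
  have h2 := h.le_dist b' b (Ne.symm hne)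
  rw [dist_comm] at h2
  have h3 := dist_triangle_left (x b) (x b') y
  rw [Metric.mem_closedBall] at hb hb'
  have := mul_pos hc (h.pos b)
  have := mul_pos hc (h.pos b')
  nlinarith

theorem infDist_le_of_mem (h : IsSeparatedFamily D S x r c C B r₀) {y : Eucl d} {b : ι}
    (hb : y ∈ Metric.closedBall (x b) (c / 2 * r b)) :
    Metric.infDist y S ≤ (C + c / 2) * r b := by
  have h1 := Metric.infDist_le_infDist_add_dist (s := S) (x := y) (y := x b)
  have h2 := h.infDist_le b
  rw [Metric.mem_closedBall] at hb
  linarith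

theorem le_infDist_of_mem (h : IsSeparatedFamily D S x r c C B r₀) {T : Set (Eucl d)}
    (hT : T.Nonempty) (hTD : Disjoint T D) {y : Eucl d} {b : ι}
    (hb : y ∈ Metric.closedBall (x b) (c / 2 * r b)) : c / 2 * r b ≤ Metric.infDist y T := by
  rw [Metric.le_infDist hT]
  intro z hz
  by_contra! hlt
  refine hTD.le_bot ⟨hz, h.ball_subset b ?_⟩
  rw [Metric.mem_closedBall] at hb
  rw [Metric.mem_ball]
  linarith [dist_triangle_left z (x b) y]

theorem closedBall_subset (h : IsSeparatedFamily D S x r c C B r₀) (hc : 0 < c) (b : ι) :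
    Metric.closedBall (x b) (c / 2 * r b) ⊆ D :=
  (Metric.closedBall_subset_ball (by nlinarith [mul_pos hc (h.pos b)])).trans (h.ball_subset b)

/-- A compact subset of `D` has positive distance from `S`, whereas the ball of index `b` lies
within `(C + c / 2) * r b` of `S`. Only the finitely many large radii can matter, so the sum of
bumps is locally finite in `D`. -/
theorem exists_finset_of_isCompact (h : IsSeparatedFamily D S x r c C B r₀) (hc : 0 < c)
    (hC : 0 < C) (hS : S.Nonempty) (hSc : IsClosed S) (hSD : Disjoint S D) {K : Set (Eucl d)}
    (hK : IsCompact K) (hKD : K ⊆ D) :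
    ∃ s : Finset ι, ∀ b ∉ s, ∀ y ∈ K, y ∉ Metric.closedBall (x b) (c / 2 * r b) := by
  obtain ⟨t, ht, hsub⟩ := hK.exists_thickening_subset_open hSc.isOpen_compl
    (fun y hy hyS => hSD.le_bot ⟨hyS, hKD hy⟩)
  refine ⟨(h.finite (t / (C + c)) (by positivity)).toFinset, fun b hb y hy hyb => ?_⟩
  simp only [Finite.mem_toFinset, mem_ofPred_eq, not_le] at hb
  have hlt : Metric.infDist y S < t := by
    refine (h.infDist_le_of_mem hyb).trans_lt ?_
    rw [lt_div_iff₀ (by positivity)] at hb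
    nlinarith [mul_pos hc (h.pos b)]
  obtain ⟨z, hz, hyz⟩ := (Metric.infDist_lt_iff hS).1 hlt
  exact hsub (Metric.mem_thickening_iff.2 ⟨y, hy, by rwa [dist_comm]⟩) hz

end IsSeparatedFamily

/-- The sum of the bumps `A b · η((y - x b) / (ε r b))`, or of their partial derivatives. -/
def bumpSum {d : ℕ} {ι : Type*} (x : ι → Eucl d) (r : ι → ℝ) (ε : ℝ) (A : ι → ℝ) (α : Fin d → ℕ)
    (y : Eucl d) : ℝ :=
  ∑' b, A b * partialDeriv α (scaledBump (x b) (ε * r b)) y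

namespace IsSeparatedFamily

variable {d : ℕ} {ι : Type*} {D S : Set (Eucl d)} {x : ι → Eucl d} {r : ι → ℝ} {c C B r₀ : ℝ}
  {ε : ℝ} {A : ι → ℝ}

theorem partialDeriv_eq_zero (h : IsSeparatedFamily D S x r c C B r₀) (hε : 0 < ε) (α : Fin d → ℕ)
    {y : Eucl d} {b : ι} (hb : y ∉ Metric.closedBall (x b) (ε * r b)) :
    partialDeriv α (scaledBump (x b) (ε * r b)) y = 0 := by
  by_contra hne
  exact hb (tsupport_scaledBump_subset _ (mul_pos hε (h.pos b))
    (support_partialDeriv_subset α _ hne))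

theorem closedBall_subset_closedBall (h : IsSeparatedFamily D S x r c C B r₀)
    (hεc : ε ≤ c / 2) (b : ι) :
    Metric.closedBall (x b) (ε * r b) ⊆ Metric.closedBall (x b) (c / 2 * r b) :=
  Metric.closedBall_subset_closedBall (mul_le_mul_of_nonneg_right hεc (h.pos b).le)

theorem bumpSum_eq_of_mem (h : IsSeparatedFamily D S x r c C B r₀) (hc : 0 < c) (hε : 0 < ε)
    (hεc : ε ≤ c / 2) (α : Fin d → ℕ) {y : Eucl d} {b : ι}
    (hb : y ∈ Metric.closedBall (x b) (c / 2 * r b)) :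
    bumpSum x r ε A α y = A b * partialDeriv α (scaledBump (x b) (ε * r b)) y := by
  refine tsum_eq_single b fun b' hne => ?_
  rw [h.partialDeriv_eq_zero hε, mul_zero]
  exact fun hb' => hne (h.eq_of_mem_closedBall hc (h.closedBall_subset_closedBall hεc b' hb') hb)

theorem bumpSum_eq_zero (h : IsSeparatedFamily D S x r c C B r₀) (hε : 0 < ε) (α : Fin d → ℕ)
    {y : Eucl d} (hy : ∀ b, y ∉ Metric.closedBall (x b) (ε * r b)) :
    bumpSum x r ε A α y = 0 := by
  unfold bumpSum
  simp [h.partialDeriv_eq_zero hε α (hy _)]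

theorem exists_finset_bumpSum_eq (h : IsSeparatedFamily D S x r c C B r₀) (hc : 0 < c)
    (hC : 0 < C) (hS : S.Nonempty) (hSc : IsClosed S) (hSD : Disjoint S D) (hε : 0 < ε)
    (hεc : ε ≤ c / 2) {K : Set (Eucl d)} (hK : IsCompact K) (hKD : K ⊆ D) :
    ∃ s : Finset ι, ∀ α, ∀ y ∈ K, bumpSum x r ε A α y =
      partialDeriv α (fun z => ∑ b ∈ s, A b * scaledBump (x b) (ε * r b) z) y := by
  obtain ⟨s, hs⟩ := h.exists_finset_of_isCompact hc hC hS hSc hSD hK hKD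
  refine ⟨s, fun α y hy => ?_⟩
  have h1 : bumpSum x r ε A α y =
      ∑ b ∈ s, A b * partialDeriv α (scaledBump (x b) (ε * r b)) y := by
    refine tsum_eq_sum fun b hb => ?_
    rw [h.partialDeriv_eq_zero hε, mul_zero]
    exact fun hyb => hs b hb y hy (h.closedBall_subset_closedBall hεc b hyb)
  rw [h1]
  unfold partialDeriv
  have hsm : ∀ b, ContDiff ℝ ((directions α).length : WithTop ℕ∞) (scaledBump (x b) (ε * r b)) :=
    fun b => (contDiff_scaledBump _ _).of_le (by exact mod_cast le_top)
  rw [iteratedFDeriv_fun_sum_apply (fun b _ => (contDiff_const.mul (hsm b)).contDiffAt), sum_apply]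
  refine Finset.sum_congr rfl fun b _ => ?_
  have := iteratedFDeriv_const_smul_apply (𝕜 := ℝ) (a := A b) (x := y) (hsm b).contDiffAt
  simp only [Pi.smul_def, smul_eq_mul] at this
  rw [this]
  simp

theorem locallyIntegrableOn_bumpSum (h : IsSeparatedFamily D S x r c C B r₀) (hc : 0 < c)
    (hC : 0 < C) (hS : S.Nonempty) (hSc : IsClosed S) (hSD : Disjoint S D) (hDo : IsOpen D)
    (hε : 0 < ε) (hεc : ε ≤ c / 2) (α : Fin d → ℕ) :
    LocallyIntegrableOn (fun y => (bumpSum x r ε A α y : ℂ)) D := by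
  rw [locallyIntegrableOn_iff hDo.isLocallyClosed]
  intro K hKD hK
  obtain ⟨s, hs⟩ := h.exists_finset_bumpSum_eq (A := A) hc hC hS hSc hSD hε hεc hK hKD
  have hsm : ContDiff ℝ ∞ fun z => ∑ b ∈ s, A b * scaledBump (x b) (ε * r b) z :=
    ContDiff.sum fun b _ => contDiff_const.mul (contDiff_scaledBump _ _)
  refine IntegrableOn.congr_fun (f := fun y => ((partialDeriv α
    (fun z => ∑ b ∈ s, A b * scaledBump (x b) (ε * r b) z) y : ℝ) : ℂ)) ?_
    (fun y hy => by simp only [hs α y hy]) hK.measurableSet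
  exact (Complex.continuous_ofReal.comp
    (contDiff_partialDeriv α hsm).continuous).continuousOn.integrableOn_compact hK

/-- On the support of a test function the sum agrees with a finite sum of smooth bumps, for which
integration by parts is classical. Nothing is required of the behaviour at the boundary. -/
theorem hasWeakDeriv_bumpSum (h : IsSeparatedFamily D S x r c C B r₀) (hc : 0 < c)
    (hC : 0 < C) (hS : S.Nonempty) (hSc : IsClosed S) (hSD : Disjoint S D) (hDo : IsOpen D)
    (hε : 0 < ε) (hεc : ε ≤ c / 2) (α : Fin d → ℕ) :
    HasWeakDeriv D α (fun y => (bumpSum x r ε A 0 y : ℂ)) (fun y => (bumpSum x r ε A α y : ℂ)) := by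
  refine ⟨h.locallyIntegrableOn_bumpSum hc hC hS hSc hSD hDo hε hεc 0,
    h.locallyIntegrableOn_bumpSum hc hC hS hSc hSD hDo hε hεc α, fun θ hθ hθc hθD => ?_⟩
  obtain ⟨s, hs⟩ := h.exists_finset_bumpSum_eq (A := A) hc hC hS hSc hSD hε hεc hθc hθD
  set f : Eucl d → ℝ := fun z => ∑ b ∈ s, A b * scaledBump (x b) (ε * r b) z with hf
  have hsm : ContDiff ℝ ∞ f :=
    ContDiff.sum fun b _ => contDiff_const.mul (contDiff_scaledBump _ _)
  have e1 : ∀ y, partialDeriv α θ y • (bumpSum x r ε A 0 y : ℂ) =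
      ((partialDeriv α θ y * f y : ℝ) : ℂ) := by
    intro y
    by_cases hy : y ∈ tsupport θ
    · rw [hs 0 y hy, partialDeriv_zero]; simp
    · have : partialDeriv α θ y = 0 := by
        by_contra hne; exact hy (support_partialDeriv_subset α θ hne)
      simp [this]
  have e2 : ∀ y, θ y • (bumpSum x r ε A α y : ℂ) = ((θ y * partialDeriv α f y : ℝ) : ℂ) := by
    intro y
    by_cases hy : y ∈ tsupport θ
    · rw [hs α y hy]; simp
    · simp [image_eq_zero_of_notMem_tsupport hy]
  simp_rw [e1, e2]
  rw [setIntegral_eq_integral_of_forall_compl_eq_zero,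
    setIntegral_eq_integral_of_forall_compl_eq_zero,
    integral_complex_ofReal, integral_complex_ofReal, Complex.real_smul, ← Complex.ofReal_mul,
    ← length_directions]
  · congr 1
    exact integral_iteratedFDeriv_mul volume hθ hθc hsm _
  · intro y hy
    have := image_eq_zero_of_notMem_tsupport (fun h => hy (hθD h))
    simp [this]
  · intro y hy
    have : partialDeriv α θ y = 0 := by
      by_contra hne; exact hy (hθD (support_partialDeriv_subset α θ hne))
    simp [this]

end IsSeparatedFamily

/-! ### Weighted norms of sums of bumps -/

/-- Which of the two bounds on `t` is decisive depends on the sign of `e`; adding the two constants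
covers both signs. -/
theorem rpow_le_of_comparable {k₁ k₂ r t : ℝ} (hk₁ : 0 < k₁) (hr : 0 < r) (h1 : k₁ * r ≤ t)
    (h2 : t ≤ k₂ * r) (e : ℝ) : t ^ e ≤ (k₁ ^ e + k₂ ^ e) * r ^ e := by
  have ht : 0 < t := (mul_pos hk₁ hr).trans_le h1
  have hk₂ : 0 < k₂ := pos_of_mul_pos_left (ht.trans_le h2) hr.le
  rw [add_mul, ← Real.mul_rpow hk₁.le hr.le, ← Real.mul_rpow hk₂.le hr.le]
  rcases le_total 0 e with he | he
  · have := Real.rpow_le_rpow ht.le h2 he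
    linarith [Real.rpow_nonneg (mul_pos hk₁ hr).le e]
  · have := Real.rpow_le_rpow_of_nonpos (mul_pos hk₁ hr) h1 he
    linarith [Real.rpow_nonneg (mul_pos hk₂ hr).le e]

theorem le_rpow_of_comparable {k₁ k₂ r t : ℝ} (hk₁ : 0 < k₁) (hr : 0 < r) (h1 : k₁ * r ≤ t)
    (h2 : t ≤ k₂ * r) (e : ℝ) : (k₁ ^ (-e) + k₂ ^ (-e))⁻¹ * r ^ e ≤ t ^ e := by
  have ht : 0 < t := (mul_pos hk₁ hr).trans_le h1
  have hk₂ : 0 < k₂ := pos_of_mul_pos_left (ht.trans_le h2) hr.le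
  have h := rpow_le_of_comparable hk₁ hr h1 h2 (-e)
  rw [Real.rpow_neg ht.le, Real.rpow_neg hr.le, inv_le_iff_one_le_mul₀ (by positivity)] at h
  rw [inv_mul_le_iff₀ (by positivity)]
  have hre : 0 < r ^ e := by positivity
  calc r ^ e = r ^ e * 1 := by ring
    _ ≤ r ^ e * ((k₁ ^ (-e) + k₂ ^ (-e)) * (r ^ e)⁻¹ * t ^ e) := by gcongr
    _ = _ := by field_simp

theorem volume_closedBall_eucl {d : ℕ} (y : Eucl d) {s : ℝ} (hs : 0 ≤ s) :
    volume (Metric.closedBall y s) =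
      ENNReal.ofReal (s ^ d) * volume (Metric.closedBall (0 : Eucl d) 1) := by
  rw [Measure.addHaar_closedBall' volume y hs, finrank_euclideanSpace_fin]

theorem tsum_rpow_mul_volume {d : ℕ} {ι : Type*} {x : ι → Eucl d} {r A : ι → ℝ} {M ε : ℝ}
    (hr : ∀ b, 0 < r b) (hA : ∀ b, 0 ≤ A b) (hM : 0 ≤ M) (hε : 0 < ε) (e : ℝ) {q : ℝ} (hq : 0 ≤ q) :
    ∑' b, ENNReal.ofReal (M * A b * r b ^ e) ^ q * volume (Metric.closedBall (x b) (ε * r b)) =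
      ENNReal.ofReal (M ^ q * ε ^ d) * volume (Metric.closedBall (0 : Eucl d) 1) *
        ∑' b, ENNReal.ofReal (A b ^ q * r b ^ (d + e * q)) := by
  rw [← ENNReal.tsum_mul_left]
  refine tsum_congr fun b => ?_
  have hrb := hr b
  have hAb := hA b
  rw [volume_closedBall_eucl _ (by positivity), ENNReal.ofReal_rpow_of_nonneg (by positivity) hq,
    ← mul_assoc, ← ENNReal.ofReal_mul (by positivity),
    mul_right_comm (ENNReal.ofReal (M ^ q * ε ^ d)),
    ← ENNReal.ofReal_mul (by positivity)]
  congr 2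
  rw [Real.mul_rpow (by positivity) (by positivity), Real.mul_rpow hM hAb, ← Real.rpow_mul hrb.le,
    Real.rpow_add hrb, Real.rpow_natCast, mul_pow]
  ring

theorem volume_closedBall_zero_one_pos (d : ℕ) :
    0 < volume (Metric.closedBall (0 : Eucl d) 1) :=
  Metric.measure_closedBall_pos _ _ one_pos

namespace IsSeparatedFamily

variable {d : ℕ} {ι : Type*} {D S : Set (Eucl d)} {x : ι → Eucl d} {r : ι → ℝ}
  {c C B r₀ ε : ℝ} {A : ι → ℝ} {ρ : Eucl d → ℝ} {k₁ k₂ : ℝ}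

/-- The weight is of size `(r b)^(k-a)` and the derivative of size `A b * (r b)^(-k)`, so the order
`k` cancels and one series controls all derivatives. -/
theorem lintegral_rpow_bumpSum_lt_top [Countable ι]
    (h : IsSeparatedFamily D S x r c C B r₀) (hc : 0 < c)
    (hε : 0 < ε) (hεc : ε ≤ c / 2) (hA : ∀ b, 0 ≤ A b) (hk₁ : 0 < k₁)
    (hρ : ∀ b, ∀ y ∈ Metric.closedBall (x b) (c / 2 * r b), k₁ * r b ≤ ρ y ∧ ρ y ≤ k₂ * r b)
    {a p : ℝ} (hp : 0 < p)
    (hsum : ∑' b, ENNReal.ofReal (A b ^ p * r b ^ (d + -a * p)) ≠ ⊤) (α : Fin d → ℕ) {k : ℕ}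
    (hα : ∑ i, α i = k) :
    ∫⁻ y in D, ‖ρ y ^ ((k : ℝ) - a) • (bumpSum x r ε A α y : ℂ)‖ₑ ^ p < ⊤ := by
  obtain ⟨M, hM, hMb⟩ := exists_abs_partialDeriv_scaledBump_le d k
  set M' := (k₁ ^ ((k : ℝ) - a) + k₂ ^ ((k : ℝ) - a)) * (M * (ε ^ k)⁻¹) with hM'
  -- Positivity of `k₂` is read off at the centre of one ball, so the empty family is treated
  -- separately.
  rcases isEmpty_or_nonempty ι with hι | ⟨⟨b₀⟩⟩
  · have : ∀ y, bumpSum x r ε A α y = 0 := fun y => tsum_empty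
    simp [this, ENNReal.zero_rpow_of_pos hp]
  have hk₂ : 0 < k₂ := by
    have := hρ b₀ (x b₀) (Metric.mem_closedBall_self (by have := h.pos b₀; positivity))
    exact pos_of_mul_pos_left (lt_of_lt_of_le (mul_pos hk₁ (h.pos b₀)) (this.1.trans this.2))
      (h.pos b₀).le
  have hM'0 : 0 ≤ M' := by positivity
  have hle := lintegral_le_tsum_mul_measure (μ := volume.restrict D)
    (s := fun b => Metric.closedBall (x b) (ε * r b))
    (L := fun b => ENNReal.ofReal (M' * A b * r b ^ (-a)) ^ p)
    (h := fun y => ‖ρ y ^ ((k : ℝ) - a) • (bumpSum x r ε A α y : ℂ)‖ₑ ^ p)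
    (fun b => Metric.isClosed_closedBall.measurableSet) ?_ ?_
  · refine hle.trans_lt (lt_of_le_of_lt (ENNReal.tsum_le_tsum fun b =>
      mul_le_mul_right (Measure.restrict_apply_le D _) _) ?_)
    rw [tsum_rpow_mul_volume h.pos hA hM'0 hε (-a) hp.le]
    exact ENNReal.mul_lt_top (ENNReal.mul_lt_top ENNReal.ofReal_lt_top
      measure_closedBall_lt_top) hsum.lt_top
  · intro b y hy
    have hy' := h.closedBall_subset_closedBall hεc b hy
    have hrb := h.pos b
    refine ENNReal.rpow_le_rpow ?_ hp.le
    rw [h.bumpSum_eq_of_mem hc hε hεc α hy', ← ofReal_norm]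
    apply ENNReal.ofReal_le_ofReal
    rw [norm_smul, Complex.norm_real, norm_mul, Real.norm_of_nonneg (hA b),
      Real.norm_of_nonneg (Real.rpow_nonneg ((mul_pos hk₁ hrb).le.trans (hρ b y hy').1) _)]
    have h1 := rpow_le_of_comparable hk₁ hrb (hρ b y hy').1 (hρ b y hy').2 ((k : ℝ) - a)
    have h2 := hMb (x b) (ε * r b) (by positivity) α hα y
    have hAb := hA b
    calc _ ≤ ((k₁ ^ ((k : ℝ) - a) + k₂ ^ ((k : ℝ) - a)) * r b ^ ((k : ℝ) - a)) *
          (A b * (M * ((ε * r b) ^ k)⁻¹)) := by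
          gcongr
          exact h2
      _ = M' * A b * r b ^ (-a) := by
          rw [hM', sub_eq_add_neg, Real.rpow_add hrb, Real.rpow_natCast, mul_pow]
          field_simp
  · intro y hy
    simp [h.bumpSum_eq_zero hε α hy, ENNReal.zero_rpow_of_pos hp]

theorem memKondratiev_bumpSum [Countable ι] (h : IsSeparatedFamily D S x r c C B r₀) (hc : 0 < c)
    (hC : 0 < C) (hS : S.Nonempty) (hSc : IsClosed S) (hSD : Disjoint S D) (hDo : IsOpen D)
    (hε : 0 < ε) (hεc : ε ≤ c / 2) (hA : ∀ b, 0 ≤ A b) (hk₁ : 0 < k₁)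
    (hρ : ∀ b, ∀ y ∈ Metric.closedBall (x b) (c / 2 * r b), k₁ * r b ≤ ρ y ∧ ρ y ≤ k₂ * r b)
    {a p : ℝ} (hp : 0 < p)
    (hsum : ∑' b, ENNReal.ofReal (A b ^ p * r b ^ (d + -a * p)) ≠ ⊤) (m : ℕ) :
    MemKondratiev D ρ m a p fun y => (bumpSum x r ε A 0 y : ℂ) := by
  unfold MemKondratiev kondratievNorm
  refine (iInf₂_le (fun α y => (bumpSum x r ε A α y : ℂ)) fun α _ =>
    h.hasWeakDeriv_bumpSum hc hC hS hSc hSD hDo hε hεc α).trans_lt ?_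
  refine ENNReal.rpow_lt_top_of_nonneg (by positivity) (ne_of_lt ?_)
  refine ENNReal.sum_lt_top.2 fun k _ => ENNReal.sum_lt_top.2 fun α hα => ?_
  exact h.lintegral_rpow_bumpSum_lt_top hc hε hεc hA hk₁ hρ hp hsum α
    (Finset.mem_piAntidiag.1 hα).1

theorem pairwise_disjoint_closedBall (h : IsSeparatedFamily D S x r c C B r₀) (hc : 0 < c)
    {ε' : ℝ} (hε' : ε' ≤ c / 2) :
    Pairwise (Function.onFun Disjoint fun b => Metric.closedBall (x b) (ε' * r b)) := by
  intro b b' hne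
  rw [Function.onFun, Set.disjoint_left]
  intro y hy hy'
  exact hne (h.eq_of_mem_closedBall hc (h.closedBall_subset_closedBall hε' b hy)
    (h.closedBall_subset_closedBall hε' b' hy'))

/-- If `h` is bounded below by a multiple of `A b * r b ^ e` on the core of each ball, then the
`q`-th power of `h` has infinite integral whenever the corresponding series diverges. -/
theorem lintegral_eq_top [Countable ι] (h : IsSeparatedFamily D S x r c C B r₀) (hc : 0 < c)
    (hε : 0 < ε) (hεc : ε ≤ c / 2) (hA : ∀ b, 0 ≤ A b) {M e q : ℝ} (hM : 0 < M) (hq : 0 ≤ q)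
    (hsum : ∑' b, ENNReal.ofReal (A b ^ q * r b ^ (d + e * q)) = ⊤) {g : Eucl d → ℝ≥0∞}
    (hg : ∀ b, ∀ y ∈ Metric.closedBall (x b) (ε * r b),
      ENNReal.ofReal (M * A b * r b ^ e) ^ q ≤ g y) :
    ∫⁻ y in D, g y = ⊤ := by
  have hle := tsum_mul_measure_le_lintegral (μ := volume.restrict D)
    (s := fun b => Metric.closedBall (x b) (ε * r b)) (h := g)
    (fun b => Metric.isClosed_closedBall.measurableSet) (h.pairwise_disjoint_closedBall hc hεc) hg
  refine top_le_iff.1 (le_trans (le_of_eq ?_) hle)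
  have e1 : ∀ b, (volume.restrict D) (Metric.closedBall (x b) (ε * r b)) =
      volume (Metric.closedBall (x b) (ε * r b)) := fun b => Measure.restrict_eq_self _
    ((h.closedBall_subset_closedBall hεc b).trans (h.closedBall_subset hc b))
  simp_rw [e1]
  rw [tsum_rpow_mul_volume h.pos hA hM.le hε e hq, hsum, ENNReal.mul_top]
  exact mul_ne_zero (ENNReal.ofReal_pos.2 (by positivity)).ne'
    (volume_closedBall_zero_one_pos d).ne'

theorem bumpSum_eq_of_mem_core (h : IsSeparatedFamily D S x r c C B r₀) (hc : 0 < c) (hε : 0 < ε)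
    (hεc : ε ≤ c / 2) {b : ι} {y : Eucl d} (hy : y ∈ Metric.closedBall (x b) (ε / 2 * r b)) :
    bumpSum x r ε A 0 y = A b := by
  have hrb := h.pos b
  rw [h.bumpSum_eq_of_mem hc hε hεc 0 (h.closedBall_subset_closedBall (by linarith) b hy),
    partialDeriv_zero, scaledBump_eq_one (by positivity), mul_one]
  rwa [show ε * r b / 2 = ε / 2 * r b by ring]

theorem eLpNorm_bumpSum_eq_top [Countable ι] (h : IsSeparatedFamily D S x r c C B r₀) (hc : 0 < c)
    (hε : 0 < ε) (hεc : ε ≤ c / 2) (hA : ∀ b, 0 ≤ A b) (hk₁ : 0 < k₁) (hk₂ : 0 < k₂)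
    (hρ : ∀ b, ∀ y ∈ Metric.closedBall (x b) (c / 2 * r b), k₁ * r b ≤ ρ y ∧ ρ y ≤ k₂ * r b)
    {e τ : ℝ} (hτ : 0 < τ)
    (hsum : ∑' b, ENNReal.ofReal (A b ^ τ * r b ^ (d + e * τ)) = ⊤) :
    eLpNorm (fun y => ρ y ^ e • (bumpSum x r ε A 0 y : ℂ)) (ENNReal.ofReal τ)
      (volume.restrict D) = ⊤ := by
  rw [eLpNorm_eq_lintegral_rpow_enorm_toReal (ENNReal.ofReal_pos.2 hτ).ne' ENNReal.ofReal_ne_top,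
    ENNReal.toReal_ofReal hτ.le]
  rw [h.lintegral_eq_top hc (half_pos hε) (by linarith) hA
    (M := (k₁ ^ (-e) + k₂ ^ (-e))⁻¹) (by positivity) hτ.le hsum]
  · exact ENNReal.top_rpow_of_pos (by positivity)
  · intro b y hy
    have hrb := h.pos b
    have hy' := h.closedBall_subset_closedBall (by linarith) b hy
    refine ENNReal.rpow_le_rpow ?_ hτ.le
    rw [h.bumpSum_eq_of_mem_core hc hε hεc hy, ← ofReal_norm]
    apply ENNReal.ofReal_le_ofReal
    rw [norm_smul, Complex.norm_real, Real.norm_of_nonneg (hA b),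
      Real.norm_of_nonneg (Real.rpow_nonneg ((mul_pos hk₁ hrb).le.trans (hρ b y hy').1) _)]
    have h1 := le_rpow_of_comparable hk₁ hrb (hρ b y hy').1 (hρ b y hy').2 e
    have := mul_le_mul_of_nonneg_right h1 (hA b)
    linarith

end IsSeparatedFamily

/-- Near an edge, `ρ` is comparable to the radii of a separated family. -/
theorem IsSmoothDistance.exists_comparable {d : ℕ} {D S : Set (Eucl d)} {ρ : Eucl d → ℝ}
    (hρ : IsSmoothDistance D S ρ) (hS : S.Nonempty) (hSD : Disjoint S D) {c C : ℝ} (hc : 0 < c)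
    (hC : 0 < C) :
    ∃ k₁ k₂ s : ℝ, 0 < k₁ ∧ 0 < k₂ ∧ 0 < s ∧ ∀ {ι : Type} {x : ι → Eucl d} {r : ι → ℝ} {B r₀ : ℝ},
      IsSeparatedFamily D S x r c C B r₀ → r₀ ≤ s →
      ∀ b, ∀ y ∈ Metric.closedBall (x b) (c / 2 * r b), k₁ * r b ≤ ρ y ∧ ρ y ≤ k₂ * r b := by
  obtain ⟨ε, c', C', hε, hc', hC', heq⟩ := hρ.equiv
  -- Radii up to `ε / (C + c)` keep the balls in the neighbourhood of `S` where `ρ` is comparable to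
  -- the distance; there this distance lies between `c / 2` and `C + c / 2` times the radius.
  refine ⟨c' * (c / 2), C' * (C + c / 2), ε / (C + c), by positivity, by positivity,
    by positivity, ?_⟩
  intro ι x r B r₀ h hr b y hy
  have hrb := h.pos b
  have hle := h.infDist_le_of_mem hy
  have hlt : Metric.infDist y S < ε := by
    have h1 := (h.le b).trans hr
    rw [le_div_iff₀ (by positivity)] at h1
    nlinarith [mul_pos hc hrb]
  obtain ⟨h1, h2⟩ := heq y (h.closedBall_subset hc b hy) hlt
  have hge := h.le_infDist_of_mem hS hSD hy
  constructor
  · calc _ = c' * (c / 2 * r b) := by ring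
      _ ≤ _ := by gcongr
      _ ≤ _ := h1
  · calc _ ≤ _ := h2
      _ ≤ C' * ((C + c / 2) * r b) := by gcongr
      _ = _ := by ring

/-! ### A pointwise lower bound for the square function -/

/-- The Littlewood-Paley projection `ℱ⁻¹(φ₀(2^{-j} ·) ℱ g)` onto frequencies of size at most
`2^j`. -/
def lowFreq {d : ℕ} (φ₀ : 𝓢(Eucl d, ℂ)) (j : ℕ) (g : Eucl d → ℂ) : Eucl d → ℂ :=
  𝓕⁻ fun ξ => φ₀ (((2 : ℝ) ^ j)⁻¹ • ξ) * 𝓕 g ξ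

section LowFreq

variable {d : ℕ} (φ₀ : 𝓢(Eucl d, ℂ)) (g : 𝓢(Eucl d, ℂ))

theorem exists_norm_schwartz_le : ∃ M : ℝ, ∀ ξ, ‖φ₀ ξ‖ ≤ M := by
  obtain ⟨M, _, hM⟩ := φ₀.decay 0 0
  exact ⟨M, fun ξ => by simpa using hM ξ⟩

theorem integrable_fourier_schwartz : Integrable (𝓕 (g : Eucl d → ℂ)) := by
  rw [← SchwartzMap.fourier_coe]
  exact (𝓕 g).integrable

theorem integrable_dilate_mul_fourier (t : ℝ) :
    Integrable fun ξ => φ₀ (t • ξ) * 𝓕 (g : Eucl d → ℂ) ξ := by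
  obtain ⟨M, hM⟩ := exists_norm_schwartz_le φ₀
  exact (integrable_fourier_schwartz g).bdd_mul
    (φ₀.continuous.comp (continuous_const_smul t)).aestronglyMeasurable
    (Filter.Eventually.of_forall fun ξ => hM _)

theorem integrable_fourierInv_integrand {f : Eucl d → ℂ} (hf : Integrable f) (y : Eucl d) :
    Integrable fun v => Real.fourierChar (inner ℝ v y) • f v := by
  simpa using (Real.fourierIntegral_convergent_iff (-y)).2 hf

theorem continuous_fourierInv_of_integrable {f : Eucl d → ℂ} (hf : Integrable f) :
    Continuous (𝓕⁻ f) := by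
  have h : Continuous (𝓕 f) :=
    VectorFourier.fourierIntegral_continuous Real.continuous_fourierChar
      (by exact continuous_inner) hf
  have h2 : 𝓕⁻ f = fun w => 𝓕 f (-w) := funext fun w => Real.fourierInv_eq_fourier_neg f w
  rw [h2]
  exact h.comp continuous_neg

theorem norm_fourierInv_le (f : Eucl d → ℂ) (y : Eucl d) : ‖𝓕⁻ f y‖ ≤ ∫ v, ‖f v‖ := by
  rw [Real.fourierInv_eq]
  refine (norm_integral_le_integral_norm _).trans (le_of_eq ?_)
  simp

theorem norm_fourier_le (f : Eucl d → ℂ) (y : Eucl d) : ‖𝓕 f y‖ ≤ ∫ v, ‖f v‖ := by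
  rw [Real.fourier_eq]
  refine (norm_integral_le_integral_norm _).trans (le_of_eq ?_)
  simp

theorem lpBlock_succ_eq (j : ℕ) (y : Eucl d) :
    lpBlock φ₀ (j + 1) g y = lowFreq φ₀ (j + 1) g y - lowFreq φ₀ j g y := by
  have h1 := integrable_dilate_mul_fourier φ₀ g ((2 : ℝ) ^ (j + 1))⁻¹
  have h2 := integrable_dilate_mul_fourier φ₀ g ((2 : ℝ) ^ j)⁻¹
  simp only [lpBlock, lowFreq, dyadicFun, sub_mul]
  rw [Real.fourierInv_eq, Real.fourierInv_eq, Real.fourierInv_eq]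
  simp only [smul_sub]
  exact integral_sub (integrable_fourierInv_integrand h1 y) (integrable_fourierInv_integrand h2 y)

theorem continuous_lowFreq (j : ℕ) : Continuous (lowFreq φ₀ j g) :=
  continuous_fourierInv_of_integrable (integrable_dilate_mul_fourier φ₀ g _)

theorem continuous_lpBlock (j : ℕ) : Continuous (lpBlock φ₀ j g) := by
  cases j with
  | zero =>
    refine continuous_fourierInv_of_integrable ?_
    simpa [dyadicFun] using integrable_dilate_mul_fourier φ₀ g 1
  | succ j =>
    rw [funext fun y => lpBlock_succ_eq φ₀ g j y]
    exact (continuous_lowFreq φ₀ g _).sub (continuous_lowFreq φ₀ g _)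

theorem lowFreq_sub_lowFreq (j n : ℕ) (y : Eucl d) :
    lowFreq φ₀ (j + n) g y - lowFreq φ₀ j g y =
      ∑ l ∈ Finset.range n, lpBlock φ₀ (j + l + 1) g y := by
  simp_rw [lpBlock_succ_eq]
  exact (Finset.sum_range_sub (fun l => lowFreq φ₀ (j + l) g y) n).symm

/-- Fourier inversion with dominated convergence: `φ₀(2^(-j) ξ)` tends to `φ₀ 0 = 1`. -/
theorem tendsto_lowFreq (h0 : φ₀ 0 = 1) (j : ℕ) (y : Eucl d) :
    Filter.Tendsto (fun n => lowFreq φ₀ (j + n) g y) Filter.atTop (nhds (g y)) := by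
  obtain ⟨M, hM⟩ := exists_norm_schwartz_le φ₀
  have hinv : g y = 𝓕⁻ (𝓕 (g : Eucl d → ℂ)) y := by
    rw [g.continuous.fourierInv_fourier_eq g.integrable (integrable_fourier_schwartz g)]
  rw [hinv]
  simp only [lowFreq]
  simp_rw [Real.fourierInv_eq]
  refine tendsto_integral_of_dominated_convergence
    (fun ξ => M * ‖𝓕 (g : Eucl d → ℂ) ξ‖) (fun n => ?_)
    ((integrable_fourier_schwartz g).norm.const_mul M) (fun n => ?_) ?_
  · exact (integrable_fourierInv_integrand
      (integrable_dilate_mul_fourier φ₀ g _) y).aestronglyMeasurable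
  · refine Filter.Eventually.of_forall fun ξ => ?_
    rw [Circle.norm_smul, norm_mul]
    gcongr
    exact hM _
  · refine Filter.Eventually.of_forall fun ξ => ?_
    have h1 : Filter.Tendsto (fun n => (((2 : ℝ) ^ (j + n))⁻¹) • ξ) Filter.atTop (nhds 0) := by
      have h2 : Filter.Tendsto (fun n => ((2 : ℝ) ^ (j + n))⁻¹) Filter.atTop (nhds 0) :=
        (tendsto_pow_atTop_atTop_of_one_lt (by norm_num : (1 : ℝ) < 2)).inv_tendsto_atTop.comp
          (Filter.tendsto_add_atTop_nat j |>.congr fun n => add_comm n j)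
      simpa using h2.smul_const ξ
    have h3 := (φ₀.continuous.tendsto 0).comp h1
    rw [h0] at h3
    simpa using (h3.mul_const (𝓕 (g : Eucl d → ℂ) ξ)).const_smul (Real.fourierChar (inner ℝ ξ y))

/-- The Fourier transform of `g` is bounded by `‖g‖₁`, and dilating `φ₀` multiplies its integral by
`2^(jd)`. For a bump that is narrow on the scale `2^(-j)` this is small compared with the height. -/
theorem norm_lowFreq_le (j : ℕ) (y : Eucl d) :
    ‖lowFreq φ₀ j g y‖ ≤ ((2 : ℝ) ^ j) ^ d * (∫ ξ, ‖φ₀ ξ‖) * ∫ v, ‖g v‖ := by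
  refine (norm_fourierInv_le _ y).trans ?_
  have hint : Integrable fun ξ => ‖φ₀ (((2 : ℝ) ^ j)⁻¹ • ξ)‖ :=
    (φ₀.integrable.comp_smul (by positivity)).norm
  calc ∫ ξ, ‖φ₀ (((2 : ℝ) ^ j)⁻¹ • ξ) * 𝓕 (g : Eucl d → ℂ) ξ‖
      ≤ ∫ ξ, ‖φ₀ (((2 : ℝ) ^ j)⁻¹ • ξ)‖ * ∫ v, ‖g v‖ := by
        refine integral_mono (integrable_dilate_mul_fourier φ₀ g _).norm (hint.mul_const _) ?_
        intro ξ
        beta_reduce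
        rw [norm_mul]
        gcongr
        exact norm_fourier_le _ _
    _ = _ := by
        rw [integral_mul_const, Measure.integral_comp_smul volume (fun ξ => ‖φ₀ ξ‖),
          finrank_euclideanSpace_fin, inv_pow, inv_inv, abs_of_nonneg (by positivity), smul_eq_mul]

/-- The square function of `F^m_{τ,2}` dominates the high-frequency part of `g`. -/
theorem enorm_sub_lowFreq_le (h0 : φ₀ 0 = 1) {m : ℕ} (hm : 1 ≤ m) (j : ℕ) (y : Eucl d) :
    ENNReal.ofReal ((2 : ℝ) ^ (j * m)) * ‖g y - lowFreq φ₀ j g y‖ₑ ≤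
      (∑' l : ℕ, (ENNReal.ofReal ((2 : ℝ) ^ ((l : ℝ) * m)) * ‖lpBlock φ₀ l g y‖ₑ) ^ (2 : ℝ))
        ^ (1 / 2 : ℝ) := by
  set Q := (∑' l : ℕ, (ENNReal.ofReal ((2 : ℝ) ^ ((l : ℝ) * m)) *
    ‖lpBlock φ₀ l g y‖ₑ) ^ (2 : ℝ)) ^ (1 / 2 : ℝ) with hQ
  set w : ℝ≥0∞ := 2 ^ m with hw
  have hw0 : w ≠ 0 := by simp [hw]
  have hwt : w ≠ ⊤ := by simp [hw]
  have hpow : ∀ l : ℕ, ENNReal.ofReal ((2 : ℝ) ^ (l * m)) = w ^ l := by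
    intro l
    rw [ENNReal.ofReal_pow (by norm_num), hw, ← pow_mul, mul_comm l m]
    simp
  have hterm : ∀ l : ℕ, ‖lpBlock φ₀ l g y‖ₑ ≤ w⁻¹ ^ l * Q := by
    intro l
    have h1 : w ^ l * ‖lpBlock φ₀ l g y‖ₑ ≤ Q := by
      have h2 := ENNReal.le_tsum (f := fun l : ℕ => (ENNReal.ofReal ((2 : ℝ) ^ ((l : ℝ) * m)) *
        ‖lpBlock φ₀ l g y‖ₑ) ^ (2 : ℝ)) l
      have h3 := ENNReal.rpow_le_rpow h2 (by norm_num : (0 : ℝ) ≤ 1 / 2)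
      rw [← ENNReal.rpow_mul] at h3
      norm_num only [ENNReal.rpow_one] at h3
      rw [← hpow l]
      refine le_trans (le_of_eq ?_) h3
      congr 2
      rw [← Nat.cast_mul, Real.rpow_natCast]
    rw [← ENNReal.inv_pow, mul_comm, ← div_eq_mul_inv, ENNReal.le_div_iff_mul_le
      (Or.inl (pow_ne_zero _ hw0)) (Or.inl (ENNReal.pow_ne_top hwt)), mul_comm]
    exact h1
  -- Here `1 ≤ m` enters: the blocks decay at least like `2^(-l)`, and the telescoping sum beyond
  -- level `j` is a geometric series with sum at most `1`.
  have hw2 : w⁻¹ ≤ 2⁻¹ := by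
    rw [ENNReal.inv_le_inv, hw]
    exact le_self_pow₀ (by norm_num) (by omega)
  have hpart : ∀ n, ‖lowFreq φ₀ (j + n) g y - lowFreq φ₀ j g y‖ₑ ≤ w⁻¹ ^ j * Q := by
    intro n
    rw [lowFreq_sub_lowFreq]
    calc _ ≤ ∑ l ∈ Finset.range n, ‖lpBlock φ₀ (j + l + 1) g y‖ₑ := enorm_sum_le _ _
      _ ≤ ∑ l ∈ Finset.range n, 2⁻¹ ^ (l + 1) * (w⁻¹ ^ j * Q) := by
          refine Finset.sum_le_sum fun l _ => (hterm _).trans ?_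
          rw [add_assoc, pow_add, mul_comm (w⁻¹ ^ j), mul_assoc]
          gcongr
      _ = (∑ l ∈ Finset.range n, 2⁻¹ ^ (l + 1)) * (w⁻¹ ^ j * Q) := by rw [Finset.sum_mul]
      _ ≤ 1 * (w⁻¹ ^ j * Q) := by
          gcongr
          refine (ENNReal.sum_le_tsum _).trans (le_of_eq ?_)
          rw [ENNReal.tsum_geometric_add_one, ENNReal.one_sub_inv_two, inv_inv,
            ENNReal.inv_mul_cancel (by norm_num) (by norm_num)]
      _ = _ := one_mul _
  have hlim : ‖g y - lowFreq φ₀ j g y‖ₑ ≤ w⁻¹ ^ j * Q :=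
    le_of_tendsto (((tendsto_lowFreq φ₀ g h0 j y).sub_const _).enorm)
      (Filter.Eventually.of_forall hpart)
  rw [hpow]
  calc _ ≤ w ^ j * (w⁻¹ ^ j * Q) := by gcongr
    _ = Q := by
      rw [← mul_assoc, ← mul_pow, ENNReal.mul_inv_cancel hw0 hwt, one_pow, one_mul]

theorem measurable_squareFunction (s τ : ℝ) :
    Measurable fun y => (∑' l : ℕ, (ENNReal.ofReal ((2 : ℝ) ^ ((l : ℝ) * s)) *
      ‖lpBlock φ₀ l g y‖ₑ) ^ (2 : ℝ)) ^ (τ / 2) := by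
  refine Measurable.pow_const (Measurable.tsum fun l => ?_) _
  exact ((continuous_lpBlock φ₀ g l).measurable.enorm.const_mul _).pow_const _

end LowFreq

/-! ### Whitney cubes near a separated family -/

theorem dist_le_of_mem_doubleCube {d : ℕ} {i : ℕ × (Fin d → ℤ)} {y z : Eucl d}
    (hy : y ∈ doubleCube i) (hz : z ∈ doubleCube i) : dist y z ≤ 2 * d * ((2 : ℝ) ^ i.1)⁻¹ := by
  have ht : (0 : ℝ) < ((2 : ℝ) ^ i.1)⁻¹ := by positivity
  set t := ((2 : ℝ) ^ i.1)⁻¹ with htdef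
  rw [EuclideanSpace.dist_eq]
  refine Real.sqrt_le_iff.2 ⟨by positivity, ?_⟩
  have h1 : ∀ n ∈ Finset.univ, dist (y n) (z n) ^ 2 ≤ (2 * t) ^ 2 := by
    intro n _
    have h2 := hy n
    have h3 := hz n
    rw [Real.dist_eq, sq_abs]
    rw [abs_lt] at h2 h3
    apply sq_le_sq'
    · linarith [h2.1, h3.2]
    · linarith [h2.2, h3.1]
  refine (Finset.sum_le_sum h1).trans ?_
  simp only [Finset.sum_const, Finset.card_univ, Fintype.card_fin, nsmul_eq_mul]
  have hd : (d : ℝ) ≤ (d : ℝ) ^ 2 := by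
    exact_mod_cast Nat.le_self_pow (by norm_num) d
  nlinarith [mul_le_mul_of_nonneg_right hd (sq_nonneg (2 * t))]

/-- The centre of the cube `Q_{j,k}`. -/
def cubeCenter {d : ℕ} (i : ℕ × (Fin d → ℤ)) : Eucl d :=
  WithLp.toLp 2 fun n => ((2 : ℝ) ^ i.1)⁻¹ * (i.2 n + 1 / 2)

theorem ball_cubeCenter_subset_dyadicCube {d : ℕ} (i : ℕ × (Fin d → ℤ)) :
    Metric.ball (cubeCenter i) (((2 : ℝ) ^ i.1)⁻¹ / 2) ⊆ dyadicCube i := by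
  intro y hy n
  rw [Metric.mem_ball, dist_eq_norm] at hy
  have h1 : |y n - ((2 : ℝ) ^ i.1)⁻¹ * (i.2 n + 1 / 2)| < ((2 : ℝ) ^ i.1)⁻¹ / 2 :=
    (PiLp.norm_apply_le (y - cubeCenter i) n).trans_lt hy
  rw [abs_lt] at h1
  constructor <;> linarith [h1.1, h1.2]

theorem cubeCenter_mem_doubleCube {d : ℕ} (i : ℕ × (Fin d → ℤ)) : cubeCenter i ∈ doubleCube i := by
  intro n
  simp [cubeCenter]

/-- Comparison of volumes: the cubes contain disjoint balls of radius `r / (4 G)`, all inside one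
ball about `y` of radius proportional to `r`. -/
theorem card_le_of_pairwiseDisjoint_dyadicCube {d : ℕ} {W : Set (ℕ × (Fin d → ℤ))}
    (hW : W.PairwiseDisjoint dyadicCube) {G : ℝ} (hG : 0 < G) {y : Eucl d} {r : ℝ} (hr : 0 < r)
    (F : Finset (ℕ × (Fin d → ℤ))) (hF : ∀ i ∈ F, i ∈ W ∧ y ∈ doubleCube i ∧
      ((2 : ℝ) ^ i.1)⁻¹ ≤ G * r ∧ r ≤ G * ((2 : ℝ) ^ i.1)⁻¹) :
    (F.card : ℝ) ≤ ((2 * d * G + 1 / (4 * G)) * (4 * G)) ^ d := by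
  set s := r / (4 * G) with hs
  have hs0 : 0 < s := by positivity
  have hsub : ∀ i ∈ F, Metric.closedBall (cubeCenter i) s ⊆ dyadicCube i := by
    intro i hi
    refine (Metric.closedBall_subset_ball ?_).trans (ball_cubeCenter_subset_dyadicCube i)
    have h1 := (hF i hi).2.2.2
    rw [hs, div_lt_iff₀ (by positivity)]
    nlinarith
  have hsub2 : (⋃ i ∈ F, Metric.closedBall (cubeCenter i) s) ⊆
      Metric.closedBall y ((2 * d * G + 1 / (4 * G)) * r) := by
    refine iUnion₂_subset fun i hi => Metric.closedBall_subset_closedBall' ?_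
    have h1 := dist_le_of_mem_doubleCube (cubeCenter_mem_doubleCube i) (hF i hi).2.1
    have h2 : 2 * d * ((2 : ℝ) ^ i.1)⁻¹ ≤ 2 * d * (G * r) := by
      gcongr; exact (hF i hi).2.2.1
    have h3 : s = 1 / (4 * G) * r := by rw [hs]; ring
    linarith
  have hdisj : (F : Set (ℕ × (Fin d → ℤ))).PairwiseDisjoint
      fun i => Metric.closedBall (cubeCenter i) s := by
    intro i hi i' hi' hne
    exact (hW (hF i hi).1 (hF i' hi').1 hne).mono (hsub i hi) (hsub i' hi')
  have hvol := measure_mono (μ := volume) hsub2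
  rw [measure_biUnion_finset hdisj fun _ _ => Metric.isClosed_closedBall.measurableSet] at hvol
  simp_rw [volume_closedBall_eucl _ hs0.le] at hvol
  rw [volume_closedBall_eucl y (s := (2 * d * G + 1 / (4 * G)) * r) (by positivity),
    Finset.sum_const, nsmul_eq_mul, ← mul_assoc,
    ENNReal.mul_le_mul_iff_left (volume_closedBall_zero_one_pos d).ne' measure_closedBall_lt_top.ne,
    ← ENNReal.ofReal_natCast, ← ENNReal.ofReal_mul (by positivity),
    ENNReal.ofReal_le_ofReal_iff (by positivity)] at hvol
  rw [← mul_le_mul_iff_left₀ (pow_pos hs0 d)]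
  refine hvol.trans (le_of_eq ?_)
  rw [← mul_pow]
  congr 1
  rw [hs]
  field_simp

namespace IsWhitneyDecomposition

variable {d : ℕ} {D S : Set (Eucl d)} {W : Set (ℕ × (Fin d → ℤ))}

/-- A Whitney cube whose double meets a ball of a separated family is of the size of the ball. -/
theorem exists_comparable (hW : IsWhitneyDecomposition D W) (hS : S.Nonempty)
    (hSf : S ⊆ frontier D) (hDo : IsOpen D) {c C : ℝ} (hc : 0 < c) (hC : 0 < C) :
    ∃ G : ℝ, 0 < G ∧ ∀ {ι : Type} {x : ι → Eucl d} {r : ι → ℝ} {B r₀ : ℝ},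
      IsSeparatedFamily D S x r c C B r₀ → r₀ ≤ 1 → ∀ b, ∀ i ∈ W, ∀ y ∈ doubleCube i,
      y ∈ Metric.closedBall (x b) (c / 2 * r b) →
      ((2 : ℝ) ^ i.1)⁻¹ ≤ G * r b ∧ r b ≤ G * ((2 : ℝ) ^ i.1)⁻¹ := by
  obtain ⟨c₁, hc₁, hlow⟩ := hW.lower
  obtain ⟨C₁, hC₁, hup⟩ := hW.upper
  have hfn : (frontier D).Nonempty := hS.mono hSf
  have hfD : Disjoint (frontier D) D := by
    rw [hDo.frontier_eq]; exact disjoint_sdiff_left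
  -- `G₁` combines the lower Whitney bound with the distance to `S ⊆ frontier D`; `G₂` combines the
  -- upper Whitney bound with the distance from the ball to the frontier. The extra `1` in the final
  -- constant serves the cubes of level `0`, which have no upper Whitney bound, but for which `r b ≤
  -- 1` suffices.
  set G₁ := (C + c / 2) / c₁
  set G₂ := (C₁ + 2 * d) / (c / 2)
  have hG₁ : 0 < G₁ := by positivity
  have hG₂ : 0 < G₂ := by positivity
  refine ⟨G₁ + G₂ + 1, by positivity, ?_⟩
  intro ι x r B r₀ h hr₀ b i hi y hy hyb
  have hrb := h.pos b
  have ht : (0 : ℝ) < ((2 : ℝ) ^ i.1)⁻¹ := by positivity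
  constructor
  · have h1 := hlow i hi y hy
    have h2 := Metric.infDist_le_infDist_of_subset (x := y) hSf hS
    have h3 := h.infDist_le_of_mem hyb
    have h4 : ((2 : ℝ) ^ i.1)⁻¹ ≤ G₁ * r b := by
      rw [div_mul_eq_mul_div, le_div_iff₀ hc₁]
      linarith
    nlinarith
  · rcases Nat.eq_zero_or_pos i.1 with h0 | hpos
    · have h1 := (h.le b).trans hr₀
      rw [h0]
      norm_num
      linarith
    · obtain ⟨z, hz, hzC⟩ := hup i hi hpos
      have h1 := h.le_infDist_of_mem hfn hfD hyb
      have h2 := Metric.infDist_le_infDist_add_dist (s := frontier D) (x := y) (y := z)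
      have h3 := dist_le_of_mem_doubleCube hy hz
      have h4 : r b ≤ G₂ * ((2 : ℝ) ^ i.1)⁻¹ := by
        rw [div_mul_eq_mul_div, le_div_iff₀ (by positivity)]
        linarith
      nlinarith

end IsWhitneyDecomposition

/-- If the nonvanishing terms of a resolution of unity are at most `N` in number, then one of them
is at least `1 / (2 (N + 1))`. -/
theorem exists_le_of_hasSum_one {ι : Type*} {f : ι → ℝ} (hf : HasSum f 1) {N : ℝ}
    (hN0 : 0 ≤ N) (hN : ∀ F : Finset ι, (∀ i ∈ F, f i ≠ 0) → (F.card : ℝ) ≤ N) :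
    ∃ i, 1 / (2 * (N + 1)) ≤ f i := by
  classical
  by_contra! hlt
  obtain ⟨F, hF⟩ := (hf.eventually (lt_mem_nhds (by norm_num : (1 / 2 : ℝ) < 1))).exists
  have h1 : ∑ i ∈ F, f i = ∑ i ∈ F.filter (fun i => f i ≠ 0), f i :=
    (Finset.sum_filter_ne_zero F).symm
  have h2 : ∑ i ∈ F.filter (fun i => f i ≠ 0), f i ≤
      (F.filter (fun i => f i ≠ 0)).card * (1 / (2 * (N + 1))) := by
    rw [← nsmul_eq_mul]
    exact Finset.sum_le_card_nsmul _ _ _ fun i _ => (hlt i).le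
  have h3 : ((F.filter (fun i => f i ≠ 0)).card : ℝ) * (1 / (2 * (N + 1))) ≤
      N * (1 / (2 * (N + 1))) := by
    gcongr
    exact hN _ fun i hi => (Finset.mem_filter.1 hi).2
  have h4 : N * (1 / (2 * (N + 1))) ≤ 1 / 2 := by
    rw [mul_one_div, div_le_div_iff₀ (by positivity) (by norm_num)]
    linarith
  linarith

/-! ### Refined localization norms of sums of bumps -/

section Rloc

variable {d : ℕ} {D S : Set (Eucl d)} {W : Set (ℕ × (Fin d → ℤ))}
  {ψ : ℕ × (Fin d → ℤ) → Eucl d → ℝ}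

/-- The product of a function of the resolution of unity and one bump, as a Schwartz function. -/
theorem exists_schwartz_eq (hψ : IsResolutionOfUnity D W ψ) {i : ℕ × (Fin d → ℤ)} (hi : i ∈ W)
    (z : Eucl d) {s : ℝ} (hs : 0 < s) (A : ℝ) :
    ∃ g : 𝓢(Eucl d, ℂ), ∀ y, g y = ((ψ i y * (A * scaledBump z s y) : ℝ) : ℂ) := by
  have hsm : ContDiff ℝ ∞ fun y => ((ψ i y * (A * scaledBump z s y) : ℝ) : ℂ) :=
    Complex.ofRealCLM.contDiff.comp
      ((hψ.contDiff i hi).mul (contDiff_const.mul (contDiff_scaledBump z s)))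
  have hcs : HasCompactSupport fun y => ((ψ i y * (A * scaledBump z s y) : ℝ) : ℂ) := by
    have h1 : HasCompactSupport fun y => ψ i y * (A * scaledBump z s y) :=
      HasCompactSupport.mul_left (HasCompactSupport.mul_left (hasCompactSupport_scaledBump z hs))
    exact h1.comp_left (g := fun t : ℝ => (t : ℂ)) (by simp)
  exact ⟨hcs.toSchwartzMap hsm, fun y => rfl⟩

theorem resolution_le_one (hψ : IsResolutionOfUnity D W ψ) {i : ℕ × (Fin d → ℤ)} (hi : i ∈ W)
    {y : Eucl d} (hy : y ∈ D) : ψ i y ≤ 1 :=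
  le_hasSum (hψ.hasSum_one y hy) ⟨i, hi⟩ fun j _ => hψ.nonneg j j.2 y

theorem integral_norm_mul_scaledBump_le (hψ : IsResolutionOfUnity D W ψ) {i : ℕ × (Fin d → ℤ)}
    (hi : i ∈ W) {z : Eucl d} {s A : ℝ} (hs : 0 < s) (hA : 0 ≤ A)
    (hball : Metric.closedBall z s ⊆ D) :
    ∫ y, ‖((ψ i y * (A * scaledBump z s y) : ℝ) : ℂ)‖ ≤
      A * (s ^ d * volume.real (Metric.closedBall (0 : Eucl d) 1)) := by
  have h0 : ∀ y ∉ Metric.closedBall z s, scaledBump z s y = 0 := fun y hy =>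
    image_eq_zero_of_notMem_tsupport fun h => hy (tsupport_scaledBump_subset z hs h)
  rw [← setIntegral_eq_integral_of_forall_compl_eq_zero (s := Metric.closedBall z s)
    fun y hy => by simp [h0 y hy]]
  have hvol : volume.real (Metric.closedBall z s) =
      s ^ d * volume.real (Metric.closedBall (0 : Eucl d) 1) := by
    rw [measureReal_def, volume_closedBall_eucl z hs.le, ENNReal.toReal_mul,
      ENNReal.toReal_ofReal (by positivity), measureReal_def]
  rw [← hvol]
  refine (Real.le_norm_self _).trans
    (norm_setIntegral_le_of_norm_le_const measure_closedBall_lt_top fun y hy => ?_)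
  rw [norm_norm, Complex.norm_real, Real.norm_of_nonneg (mul_nonneg (hψ.nonneg i hi y)
    (mul_nonneg hA (scaledBump_nonneg _ _ _)))]
  calc _ ≤ 1 * (A * 1) := by
        gcongr
        · exact mul_nonneg hA (scaledBump_nonneg _ _ _)
        · exact resolution_le_one hψ hi (hball hy)
        · exact scaledBump_le_one _ _ _
    _ = A := by ring

variable {ι : Type} {x : ι → Eucl d} {r : ι → ℝ} {c C B r₀ ε : ℝ} {A : ι → ℝ} {G : ℝ}

/-- If the separation of the family is large enough, each doubled Whitney cube meets at most one
ball. -/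
theorem IsSeparatedFamily.eq_of_mem_doubleCube (h : IsSeparatedFamily D S x r c C B r₀)
    (hc : 0 < c) (hG : 0 < G) (hB : c * G ^ 2 + 2 * d * G ≤ B)
    (hcomp : ∀ b, ∀ i ∈ W, ∀ y ∈ doubleCube i, y ∈ Metric.closedBall (x b) (c / 2 * r b) →
      ((2 : ℝ) ^ i.1)⁻¹ ≤ G * r b ∧ r b ≤ G * ((2 : ℝ) ^ i.1)⁻¹)
    {i : ℕ × (Fin d → ℤ)} (hi : i ∈ W) {y y' : Eucl d} (hy : y ∈ doubleCube i)
    (hy' : y' ∈ doubleCube i) {b b' : ι} (hb : y ∈ Metric.closedBall (x b) (c / 2 * r b))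
    (hb' : y' ∈ Metric.closedBall (x b') (c / 2 * r b')) : b = b' := by
  by_contra hne
  have hlt := h.lt_dist b b' hne
  obtain ⟨h1, h2⟩ := hcomp b i hi y hy hb
  obtain ⟨h3, h4⟩ := hcomp b' i hi y' hy' hb'
  have h5 := dist_le_of_mem_doubleCube hy hy'
  set t := ((2 : ℝ) ^ i.1)⁻¹ with ht
  have ht0 : 0 < t := by positivity
  rw [Metric.mem_closedBall] at hb hb'
  have h6 : dist (x b) (x b') ≤ c / 2 * r b + 2 * d * t + c / 2 * r b' := by
    have e1 := dist_triangle (x b) y (x b')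
    have e2 := dist_triangle y y' (x b')
    rw [dist_comm] at hb
    linarith
  have h7 : dist (x b) (x b') ≤ (c * G + 2 * d) * t := by
    have e1 : c / 2 * r b ≤ c / 2 * (G * t) := by gcongr
    have e2 : c / 2 * r b' ≤ c / 2 * (G * t) := by gcongr
    linarith
  have hmin : 0 < min (r b) (r b') := lt_min (h.pos b) (h.pos b')
  have h8 : t ≤ G * min (r b) (r b') := by
    rw [mul_min_of_nonneg _ _ hG.le]; exact le_min h1 h3
  have h9 : (c * G + 2 * d) * t ≤ B * min (r b) (r b') := by
    calc _ ≤ (c * G + 2 * d) * (G * min (r b) (r b')) := by gcongr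
      _ = (c * G ^ 2 + 2 * d * G) * min (r b) (r b') := by ring
      _ ≤ _ := by gcongr
  linarith

theorem IsSeparatedFamily.smul_bumpSum_eq (h : IsSeparatedFamily D S x r c C B r₀)
    (hc : 0 < c) (hG : 0 < G) (hB : c * G ^ 2 + 2 * d * G ≤ B)
    (hcomp : ∀ b, ∀ i ∈ W, ∀ y ∈ doubleCube i, y ∈ Metric.closedBall (x b) (c / 2 * r b) →
      ((2 : ℝ) ^ i.1)⁻¹ ≤ G * r b ∧ r b ≤ G * ((2 : ℝ) ^ i.1)⁻¹) (hψ : IsResolutionOfUnity D W ψ)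
    (hε : 0 < ε) (hεc : ε ≤ c / 2) {i : ℕ × (Fin d → ℤ)} (hi : i ∈ W) {b : ι} {y₀ : Eucl d}
    (hy₀ : y₀ ∈ doubleCube i) (hb : y₀ ∈ Metric.closedBall (x b) (ε * r b)) (y : Eucl d) :
    ψ i y • (bumpSum x r ε A 0 y : ℂ) =
      ((ψ i y * (A b * scaledBump (x b) (ε * r b) y) : ℝ) : ℂ) := by
  rw [Complex.real_smul, ← Complex.ofReal_mul]
  congr 1
  by_cases hy : y ∈ doubleCube i
  · congr 1
    by_cases hyb : y ∈ Metric.closedBall (x b) (ε * r b)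
    · rw [h.bumpSum_eq_of_mem hc hε hεc 0 (h.closedBall_subset_closedBall hεc b hyb),
        partialDeriv_zero]
    · rw [h.bumpSum_eq_zero hε]
      · rw [← partialDeriv_zero (scaledBump (x b) (ε * r b)), h.partialDeriv_eq_zero hε 0 hyb,
          mul_zero]
      · intro b' hyb'
        have := h.eq_of_mem_doubleCube hc hG hB hcomp hi hy₀ hy
          (h.closedBall_subset_closedBall hεc b hb) (h.closedBall_subset_closedBall hεc b' hyb')
        exact hyb (this ▸ hyb')
  · have : ψ i y = 0 := image_eq_zero_of_notMem_tsupport fun hn => hy (hψ.tsupport_subset i hi hn)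
    simp [this]

/-- Each localized piece is a single smooth bump or zero, which makes its Littlewood-Paley blocks
continuous and its square function measurable. -/
theorem IsSeparatedFamily.exists_schwartz_smul_bumpSum_eq
    (h : IsSeparatedFamily D S x r c C B r₀)
    (hc : 0 < c) (hG : 0 < G) (hB : c * G ^ 2 + 2 * d * G ≤ B)
    (hcomp : ∀ b, ∀ i ∈ W, ∀ y ∈ doubleCube i, y ∈ Metric.closedBall (x b) (c / 2 * r b) →
      ((2 : ℝ) ^ i.1)⁻¹ ≤ G * r b ∧ r b ≤ G * ((2 : ℝ) ^ i.1)⁻¹) (hψ : IsResolutionOfUnity D W ψ)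
    (hε : 0 < ε) (hεc : ε ≤ c / 2) {i : ℕ × (Fin d → ℤ)} (hi : i ∈ W) :
    ∃ g : 𝓢(Eucl d, ℂ), (fun y => ψ i y • (bumpSum x r ε A 0 y : ℂ)) = g := by
  by_cases hex : ∃ b, ∃ y₀ ∈ doubleCube i, y₀ ∈ Metric.closedBall (x b) (ε * r b)
  · obtain ⟨b, y₀, hy₀, hb⟩ := hex
    obtain ⟨g, hg⟩ := exists_schwartz_eq hψ hi (x b) (mul_pos hε (h.pos b)) (A b)
    refine ⟨g, funext fun y => ?_⟩
    rw [h.smul_bumpSum_eq hc hG hB hcomp hψ hε hεc hi hy₀ hb, hg]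
  · push Not at hex
    refine ⟨0, funext fun y => ?_⟩
    by_cases hy : y ∈ doubleCube i
    · simp [h.bumpSum_eq_zero (A := A) hε 0 fun b => hex b y hy]
    · have : ψ i y = 0 :=
        image_eq_zero_of_notMem_tsupport fun hn => hy (hψ.tsupport_subset i hi hn)
      simp [this]

/-- On the core of each ball, one of the square functions of the localized pieces is of the size
of the amplitude times `r b ^ (-m)`. -/
theorem IsSeparatedFamily.exists_le_squareFunction (h : IsSeparatedFamily D S x r c C B r₀)
    (hc : 0 < c) (hG : 0 < G) (hB : c * G ^ 2 + 2 * d * G ≤ B)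
    (hcomp : ∀ b, ∀ i ∈ W, ∀ y ∈ doubleCube i, y ∈ Metric.closedBall (x b) (c / 2 * r b) →
      ((2 : ℝ) ^ i.1)⁻¹ ≤ G * r b ∧ r b ≤ G * ((2 : ℝ) ^ i.1)⁻¹)
    (hW : W.PairwiseDisjoint dyadicCube) (hψ : IsResolutionOfUnity D W ψ)
    {φ₀ : 𝓢(Eucl d, ℂ)} (hφ₀ : φ₀ 0 = 1) (hε : 0 < ε) (hεc : ε ≤ c / 2) (hA : ∀ b, 0 ≤ A b)
    {ν : ℝ} (hν : ν = 1 / (2 * (((2 * d * G + 1 / (4 * G)) * (4 * G)) ^ d + 1)))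
    (hεν : G ^ d * (∫ ξ, ‖φ₀ ξ‖) * (ε ^ d * volume.real (Metric.closedBall (0 : Eucl d) 1)) ≤ ν / 2)
    {m : ℕ} (hm : 1 ≤ m) (b : ι) {y : Eucl d} (hy : y ∈ Metric.closedBall (x b) (ε / 2 * r b)) :
    ∃ i ∈ W, ENNReal.ofReal (ν / 2 * (G ^ m)⁻¹ * A b * r b ^ (-(m : ℝ))) ≤
      (∑' l : ℕ, (ENNReal.ofReal ((2 : ℝ) ^ ((l : ℝ) * m)) *
        ‖lpBlock φ₀ l (fun z => ψ i z • (bumpSum x r ε A 0 z : ℂ)) y‖ₑ) ^ (2 : ℝ))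
        ^ (1 / 2 : ℝ) := by
  have hrb := h.pos b
  have hAb := hA b
  have hyε : y ∈ Metric.closedBall (x b) (ε * r b) :=
    Metric.closedBall_subset_closedBall (by nlinarith [mul_pos hε hrb]) hy
  have hyc := h.closedBall_subset_closedBall hεc b hyε
  have hyD := h.closedBall_subset hc b hyc
  have hmem : ∀ i ∈ W, ψ i y ≠ 0 → y ∈ doubleCube i := fun i hi hne =>
    hψ.tsupport_subset i hi (subset_tsupport _ hne)
  -- At most `N` functions of the resolution are nonzero at `y`, so one of them is at least `ν`
  -- there.
  obtain ⟨⟨i, hi⟩, hνi⟩ := exists_le_of_hasSum_one (hψ.hasSum_one y hyD)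
    (N := ((2 * d * G + 1 / (4 * G)) * (4 * G)) ^ d) (by positivity) (by
      intro F hF
      have := card_le_of_pairwiseDisjoint_dyadicCube hW hG (y := y) hrb
        (F.map (Function.Embedding.subtype _)) (by
          intro i hi
          obtain ⟨⟨j, hj⟩, hjF, rfl⟩ := Finset.mem_map.1 hi
          have hyj := hmem j hj (hF _ hjF)
          exact ⟨hj, hyj, hcomp b j hj y hyj hyc⟩)
      simpa using this)
  rw [← hν] at hνi
  have hν0 : 0 < ν := by rw [hν]; positivity
  have hyi : y ∈ doubleCube i := hmem i hi (hν0.trans_le hνi).ne'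
  obtain ⟨hGi, hGi'⟩ := hcomp b i hi y hyi hyc
  obtain ⟨g, hg⟩ := exists_schwartz_eq hψ hi (x b) (mul_pos hε hrb) (A b)
  have hgeq : (fun z => ψ i z • (bumpSum x r ε A 0 z : ℂ)) = g := funext fun z => by
    rw [h.smul_bumpSum_eq hc hG hB hcomp hψ hε hεc hi hyi hyε, hg]
  refine ⟨i, hi, ?_⟩
  rw [hgeq]
  -- The frequency cut is made at the level of the cube, where `2^j` is comparable to `1 / r b`.
  refine le_trans ?_ (enorm_sub_lowFreq_le φ₀ g hφ₀ hm i.1 y)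
  rw [← ofReal_norm, ← ENNReal.ofReal_mul (by positivity)]
  apply ENNReal.ofReal_le_ofReal
  have hgy : g y = ((ψ i y * A b : ℝ) : ℂ) := by
    rw [hg, scaledBump_eq_one (by positivity), mul_one]
    rwa [show ε * r b / 2 = ε / 2 * r b by ring]
  have hg1 : ν * A b ≤ ‖g y‖ := by
    rw [hgy, Complex.norm_real, Real.norm_of_nonneg (mul_nonneg (hν0.le.trans hνi) hAb)]
    gcongr
  -- The integral of the piece is at most `A b * (ε * r b)^d` up to the volume of the unit ball, and
  -- `2^j * r b ≤ G`; the smallness of `ε` does the rest.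
  have hlow : ‖lowFreq φ₀ i.1 g y‖ ≤ ν / 2 * A b := by
    refine (norm_lowFreq_le φ₀ g i.1 y).trans ?_
    have hint : ∫ v, ‖g v‖ ≤ A b * ((ε * r b) ^ d *
        volume.real (Metric.closedBall (0 : Eucl d) 1)) := by
      simp_rw [hg]
      exact integral_norm_mul_scaledBump_le hψ hi (by positivity) hAb
        ((h.closedBall_subset_closedBall hεc b).trans (h.closedBall_subset hc b))
    have hI : 0 ≤ ∫ ξ, ‖φ₀ ξ‖ := integral_nonneg fun _ => norm_nonneg _
    have h2r : (2 : ℝ) ^ i.1 * r b ≤ G := by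
      rw [← div_eq_mul_inv, le_div_iff₀ (by positivity)] at hGi'
      linarith
    calc _ ≤ ((2 : ℝ) ^ i.1) ^ d * (∫ ξ, ‖φ₀ ξ‖) * (A b * ((ε * r b) ^ d *
          volume.real (Metric.closedBall (0 : Eucl d) 1))) := by gcongr
      _ = ((2 : ℝ) ^ i.1 * r b) ^ d * (∫ ξ, ‖φ₀ ξ‖) * (ε ^ d *
          volume.real (Metric.closedBall (0 : Eucl d) 1)) * A b := by
          rw [mul_pow, mul_pow]; ring
      _ ≤ G ^ d * (∫ ξ, ‖φ₀ ξ‖) * (ε ^ d *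
          volume.real (Metric.closedBall (0 : Eucl d) 1)) * A b := by gcongr
      _ ≤ _ := by gcongr
  have hdiff : ν / 2 * A b ≤ ‖g y - lowFreq φ₀ i.1 g y‖ := by
    have := norm_sub_norm_le (g y) (lowFreq φ₀ i.1 g y)
    linarith
  have hpow : (G ^ m)⁻¹ * r b ^ (-(m : ℝ)) ≤ (2 : ℝ) ^ (i.1 * m) := by
    rw [Real.rpow_neg hrb.le, Real.rpow_natCast, ← mul_inv, ← mul_pow, pow_mul,
      inv_le_comm₀ (by positivity) (by positivity), ← inv_pow]
    gcongr
  calc _ = ((G ^ m)⁻¹ * r b ^ (-(m : ℝ))) * (ν / 2 * A b) := by ring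
    _ ≤ _ := by gcongr

end Rloc

/-- The `τ`-th power of the quasi-norm is the integral of the sum over all cubes of the `τ`-th
powers of the square functions, and at each point of a core one summand already has size `(A b * (r
b)^(-m))^τ`. The constants `B` and `ε` are fixed before the family, so that the family can then be
built with separation `B`. -/
theorem IsDomainWithSingularSet.rlocNorm_bumpSum_eq_top {d δ : ℕ} {D S : Set (Eucl d)}
    (hD : IsDomainWithSingularSet D S δ) (hd : d ≠ 0) (hS : S.Nonempty)
    {W : Set (ℕ × (Fin d → ℤ))} {ψ : ℕ × (Fin d → ℤ) → Eucl d → ℝ} {φ₀ : 𝓢(Eucl d, ℂ)}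
    (hW : IsWhitneyDecomposition D W) (hψ : IsResolutionOfUnity D W ψ)
    (hφ₀ : IsDyadicGenerator φ₀) {c C : ℝ} (hc : 0 < c) (hC : 0 < C) :
    ∃ B ε : ℝ, 0 < B ∧ 0 < ε ∧ ε ≤ c / 2 ∧ ∀ {ι : Type} [Countable ι] {x : ι → Eucl d}
      {r : ι → ℝ} {r₀ : ℝ} {A : ι → ℝ} {m : ℕ} {τ : ℝ}, IsSeparatedFamily D S x r c C B r₀ →
      r₀ ≤ 1 → (∀ b, 0 ≤ A b) → 1 ≤ m → 0 < τ →
      ∑' b, ENNReal.ofReal (A b ^ τ * r b ^ (d + -(m : ℝ) * τ)) = ⊤ →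
      rlocNorm W ψ φ₀ m τ 2 (fun y => (bumpSum x r ε A 0 y : ℂ)) = ⊤ := by
  obtain ⟨G, hG, hcomp⟩ := hW.exists_comparable hS hD.subset_frontier hD.isOpen hc hC
  have hφ0 : φ₀ 0 = 1 := hφ₀.1 0 (by simp)
  set ν : ℝ := 1 / (2 * (((2 * d * G + 1 / (4 * G)) * (4 * G)) ^ d + 1)) with hν
  have hν0 : 0 < ν := by positivity
  set I : ℝ := G ^ d * (∫ ξ, ‖φ₀ ξ‖) * volume.real (Metric.closedBall (0 : Eucl d) 1) with hI
  have hI0 : 0 ≤ I := mul_nonneg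
    (mul_nonneg (by positivity) (integral_nonneg fun _ => norm_nonneg _)) measureReal_nonneg
  -- `ε ≤ 1` gives `ε ^ d ≤ ε` as `d ≠ 0`, `ε ≤ c / 2` keeps the bumps disjoint, and the last bound
  -- makes their low-frequency part at most half of the main term.
  set ε : ℝ := min (min 1 (c / 2)) (ν / 2 / (I + 1)) with hεdef
  have hε : 0 < ε := by positivity
  have hε1 : ε ≤ 1 := (min_le_left _ _).trans (min_le_left _ _)
  have hεc : ε ≤ c / 2 := (min_le_left _ _).trans (min_le_right _ _)
  have hεI : ε * (I + 1) ≤ ν / 2 := by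
    rw [← le_div_iff₀ (by positivity)]; exact min_le_right _ _
  have hεν : G ^ d * (∫ ξ, ‖φ₀ ξ‖) *
      (ε ^ d * volume.real (Metric.closedBall (0 : Eucl d) 1)) ≤ ν / 2 := by
    calc _ = ε ^ d * I := by rw [hI]; ring
      _ ≤ ε * I := by gcongr; exact pow_le_of_le_one hε.le hε1 hd
      _ ≤ _ := by nlinarith
  refine ⟨c * G ^ 2 + 2 * d * G, ε, by positivity, hε, hεc, ?_⟩
  intro ι _ x r r₀ A m τ h hr₀ hA hm hτ hsum
  have hcomp' := hcomp h hr₀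
  unfold rlocNorm triebelLizorkinNorm
  have hinner : ∀ i : W, ((∫⁻ y, (∑' j : ℕ, (ENNReal.ofReal ((2 : ℝ) ^ ((j : ℝ) * (m : ℝ))) *
      ‖lpBlock φ₀ j (fun z => ψ i z • (bumpSum x r ε A 0 z : ℂ)) y‖ₑ) ^ (2 : ℝ)) ^ (τ / 2))
        ^ (1 / τ)) ^ τ = ∫⁻ y, (∑' j : ℕ, (ENNReal.ofReal ((2 : ℝ) ^ ((j : ℝ) * (m : ℝ))) *
      ‖lpBlock φ₀ j (fun z => ψ i z • (bumpSum x r ε A 0 z : ℂ)) y‖ₑ) ^ (2 : ℝ)) ^ (τ / 2) := by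
    intro i
    rw [← ENNReal.rpow_mul, one_div_mul_cancel hτ.ne', ENNReal.rpow_one]
  simp_rw [hinner]
  -- The sum over the cubes is taken inside the integral, since the cube with the large square
  -- function varies with the point.
  rw [← lintegral_tsum]
  · rw [top_le_iff.1 (le_trans (le_of_eq (h.lintegral_eq_top hc (half_pos hε) (by linarith) hA
      (M := ν / 2 * (G ^ m)⁻¹) (by positivity) hτ.le hsum ?_).symm)
      (setLIntegral_le_lintegral D _))]
    · exact ENNReal.top_rpow_of_pos (by positivity)
    · intro b y hy
      obtain ⟨i, hi, hle⟩ := h.exists_le_squareFunction hc hG le_rfl hcomp' hW.pairwiseDisjoint hψ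
        hφ0 hε hεc hA hν hεν hm b hy
      refine le_trans ?_ (ENNReal.le_tsum (⟨i, hi⟩ : W))
      refine (ENNReal.rpow_le_rpow hle hτ.le).trans (le_of_eq ?_)
      rw [← ENNReal.rpow_mul]
      congr 1
      ring
  · intro i
    obtain ⟨g, hg⟩ := h.exists_schwartz_smul_bumpSum_eq (A := A) hc hG le_rfl hcomp' hψ hε hεc i.2
    rw [hg]
    exact (measurable_squareFunction φ₀ g m τ).aemeasurable

/-! ### Amplitudes along an edge -/

/-- The amplitude of the bumps of generation `n` along an edge. -/
def edgeAmplitude {δ R : ℕ} (κ σ τ : ℝ) (b : EdgeIndex δ R) : ℝ :=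
  edgeRadius κ b ^ σ * ((b.1 : ℝ) + 1) ^ (-(1 / τ))

theorem edgeAmplitude_nonneg {δ R : ℕ} {κ : ℝ} (hκ : 0 < κ) (hR : 2 ≤ R) (σ τ : ℝ)
    (b : EdgeIndex δ R) : 0 ≤ edgeAmplitude κ σ τ b := by
  have := edgeRadius_pos hκ hR b
  unfold edgeAmplitude
  positivity

/-- Generation `n` has `R^(nδ)` points of radius `κ R⁻ⁿ`, so its radii to the power `δ` add up to
`κ^δ`, whatever `n` is. -/
theorem tsum_edgeRadius_pow_mul {δ R : ℕ} {κ : ℝ} (hκ : 0 < κ) (hR : 2 ≤ R) (f : ℕ → ℝ) :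
    ∑' b : EdgeIndex δ R, ENNReal.ofReal (edgeRadius κ b ^ (δ : ℝ) * f b.1) =
      ENNReal.ofReal (κ ^ δ) * ∑' n, ENNReal.ofReal (f n) := by
  rw [ENNReal.tsum_sigma', ← ENNReal.tsum_mul_left]
  refine tsum_congr fun n => ?_
  have hRn : (0 : ℝ) < (R : ℝ) ^ n := by positivity
  simp only [edgeRadius]
  rw [tsum_fintype, Finset.sum_const, Finset.card_univ, Fintype.card_fun, Fintype.card_fin,
    Fintype.card_fin, nsmul_eq_mul, ← ENNReal.ofReal_natCast, ← ENNReal.ofReal_mul (by positivity),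
    ← ENNReal.ofReal_mul (by positivity), Real.rpow_natCast]
  congr 1
  rw [mul_pow]
  push_cast
  rw [inv_pow]
  field_simp

theorem edgeAmplitude_rpow_mul {δ R : ℕ} {κ : ℝ} (hκ : 0 < κ) (hR : 2 ≤ R) (σ τ q e : ℝ)
    (b : EdgeIndex δ R) :
    edgeAmplitude κ σ τ b ^ q * edgeRadius κ b ^ e =
      edgeRadius κ b ^ (σ * q + e) * ((b.1 : ℝ) + 1) ^ (-(q / τ)) := by
  have hr := edgeRadius_pos hκ hR b
  unfold edgeAmplitude
  rw [Real.mul_rpow (by positivity) (by positivity), ← Real.rpow_mul hr.le,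
    ← Real.rpow_mul (by positivity), Real.rpow_add hr, show -(1 / τ) * q = -(q / τ) by ring]
  ring

theorem tsum_edgeAmplitude_ne_top {δ R : ℕ} {κ : ℝ} (hκ : 0 < κ) (hR : 2 ≤ R) {σ τ p e : ℝ}
    (hτ : 0 < τ) (hτp : τ < p) (he : σ * p + e = δ) :
    ∑' b : EdgeIndex δ R, ENNReal.ofReal (edgeAmplitude κ σ τ b ^ p * edgeRadius κ b ^ e) ≠ ⊤ := by
  simp_rw [edgeAmplitude_rpow_mul hκ hR, he]
  rw [tsum_edgeRadius_pow_mul hκ hR fun n => ((n : ℝ) + 1) ^ (-(p / τ))]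
  refine ENNReal.mul_ne_top ENNReal.ofReal_ne_top ?_
  have hs : Summable fun n : ℕ => ((n : ℝ) + 1) ^ (-(p / τ)) := by
    have h1 : 1 < p / τ := (one_lt_div hτ).2 hτp
    have h2 := (summable_nat_add_iff 1).2 (Real.summable_nat_rpow.2 (by linarith : -(p / τ) < -1))
    simpa using h2
  exact hs.tsum_ofReal_ne_top

/-- As the radii are at most `1`, lowering the exponent below `δ` only enlarges the terms; at
exponent `δ` the series is a multiple of the harmonic series. -/
theorem tsum_edgeAmplitude_eq_top {δ R : ℕ} {κ : ℝ} (hκ : 0 < κ) (hκ1 : κ ≤ 1) (hR : 2 ≤ R)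
    {σ τ e : ℝ} (hτ : 0 < τ) (he : σ * τ + e ≤ δ) :
    ∑' b : EdgeIndex δ R, ENNReal.ofReal (edgeAmplitude κ σ τ b ^ τ * edgeRadius κ b ^ e) = ⊤ := by
  have htop : ∑' b : EdgeIndex δ R, ENNReal.ofReal (edgeRadius κ b ^ (δ : ℝ) *
      ((b.1 : ℝ) + 1)⁻¹) = ⊤ := by
    rw [tsum_edgeRadius_pow_mul hκ hR fun n => ((n : ℝ) + 1)⁻¹]
    have h1 : ∑' n : ℕ, ENNReal.ofReal ((n : ℝ) + 1)⁻¹ = ⊤ := by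
      by_contra hne
      have h2 := ENNReal.summable_toReal hne
      have h3 : Summable fun n : ℕ => ((n : ℝ) + 1)⁻¹ := by
        refine h2.congr fun n => ENNReal.toReal_ofReal (by positivity)
      refine Real.not_summable_natCast_inv ((summable_nat_add_iff 1).1 ?_)
      simpa using h3
    rw [h1, ENNReal.mul_top (ENNReal.ofReal_pos.2 (by positivity)).ne']
  refine top_le_iff.1 (htop.symm.le.trans (ENNReal.tsum_le_tsum fun b => ?_))
  apply ENNReal.ofReal_le_ofReal
  have hr := edgeRadius_pos hκ hR b
  rw [edgeAmplitude_rpow_mul hκ hR, div_self hτ.ne', Real.rpow_neg_one]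
  gcongr ?_ * _
  exact Real.rpow_le_rpow_of_exponent_ge hr ((edgeRadius_le hκ hR b).trans hκ1) he

/-! ### Elementary consequences of the edge condition -/

theorem IsDomainWithSingularSet.nonempty {d δ : ℕ} {D S : Set (Eucl d)}
    (hD : IsDomainWithSingularSet D S δ) : S.Nonempty := by
  obtain ⟨x₀, V, K, Φ, -, -, -, -, -, -, -, hxs, hx0, hDS⟩ := hD.exists_edge
  exact ⟨x₀, (hDS x₀ hxs).1.2 (by rw [hx0]; exact V.zero_mem)⟩

theorem IsDomainWithSingularSet.disjoint {d δ : ℕ} {D S : Set (Eucl d)}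
    (hD : IsDomainWithSingularSet D S δ) : Disjoint S D := by
  refine Disjoint.mono_left hD.subset_frontier ?_
  rw [hD.isOpen.frontier_eq]
  exact disjoint_sdiff_left

/-- In a one-point space a nonempty `D` is everything and has no frontier, which leaves no place for
the edge point. Positive dimension is what makes `ε ^ d` small with `ε`. -/
theorem IsDomainWithSingularSet.dim_ne_zero {d δ : ℕ} {D S : Set (Eucl d)}
    (hD : IsDomainWithSingularSet D S δ) : d ≠ 0 := by
  rintro rfl
  obtain ⟨x, hx⟩ := hD.nonempty
  have hfr := hD.subset_frontier hx
  rw [hD.isOpen.frontier_eq] at hfr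
  obtain ⟨y, hy⟩ := closure_nonempty_iff.1 ⟨x, hfr.1⟩
  exact hfr.2 (Subsingleton.elim y x ▸ hy)

end

/-! ### The counterexample and the failure of the embedding -/

theorem proposition4p1 {d δ : ℕ} {D S : Set (Eucl d)} (hD : IsDomainWithSingularSet D S δ)
    {ρ : Eucl d → ℝ} (hρ : IsSmoothDistance D S ρ)
    {m : ℕ} (hm : 1 ≤ m) {a p τ : ℝ} (hp : 1 < p) (hτ : 0 < τ) (hτp : τ < p)
    (h : ((m : ℝ) - a = ((d : ℝ) - δ) * (1 / τ - 1 / p) ∧ a < m) ∨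
      ((d : ℝ) - δ) * (1 / τ - 1 / p) < (m : ℝ) - a) :
    (∃ u : Eucl d → ℂ, MemKondratiev D ρ m a p u ∧
      eLpNorm (fun x => ρ x ^ (-(m : ℝ)) • u x) (ENNReal.ofReal τ) (volume.restrict D) = ⊤) ∧
    ∀ (W : Set (ℕ × (Fin d → ℤ))) (ψ : ℕ × (Fin d → ℤ) → Eucl d → ℝ) (φ₀ : 𝓢(Eucl d, ℂ)),
      IsWhitneyDecomposition D W → IsResolutionOfUnity D W ψ → IsDyadicGenerator φ₀ →
      ¬ KondratievEmbedsRloc D ρ m a p τ W ψ φ₀ := by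
  have hp0 : 0 < p := by linarith
  obtain ⟨c, C, hc, hC, hfam⟩ := exists_isSeparatedFamily hD
  obtain ⟨k₁, k₂, s, hk₁, hk₂, hs, hcomp⟩ :=
    hρ.exists_comparable hD.nonempty hD.disjoint hc hC
  have hr₀ : 0 < min s 1 := by positivity
  -- The critical exponent: the Kondratiev series has radii to the power exactly `δ`, and only the
  -- logarithmic factor `(n+1)^(-p/τ)` makes it converge.
  set σ : ℝ := a - ((d : ℝ) - δ) / p with hσ
  have hσp : σ * p + (d + -a * p) = δ := by rw [hσ]; field_simp; ring
  have hστ : σ * τ + (d + -(m : ℝ) * τ) ≤ δ := by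
    have hle : ((d : ℝ) - δ) * (1 / τ - 1 / p) ≤ (m : ℝ) - a := h.elim (fun h => h.1.ge) le_of_lt
    have h1 := mul_le_mul_of_nonneg_right hle hτ.le
    have h2 : ((d : ℝ) - δ) * (1 / τ - 1 / p) * τ = (d - δ) - (d - δ) / p * τ := by
      field_simp
    rw [hσ]
    nlinarith
  -- Generation `0` always contains a point, and its radius is `κ`.
  have hκ1 : ∀ {κ : ℝ} {R : ℕ} {x : EdgeIndex δ R → Eucl d} {B : ℝ}, 2 ≤ R →
      IsSeparatedFamily D S x (edgeRadius κ) c C B (min s 1) → κ ≤ 1 := by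
    intro κ R x B hR hx
    have hpos : 0 < R ^ 0 := by simp
    have h1 := (hx.le ⟨0, fun _ => ⟨0, hpos⟩⟩).trans (min_le_right _ _)
    simpa [edgeRadius] using h1
  constructor
  -- Any separation factor will do here, since no Whitney cubes are involved.
  · obtain ⟨κ, R, hκ, hR, x, hx⟩ := hfam 1 (min s 1) one_pos hr₀
    have hA := edgeAmplitude_nonneg (δ := δ) hκ hR σ τ
    have hρx := hcomp hx (min_le_left _ _)
    exact ⟨_, hx.memKondratiev_bumpSum hc hC hD.nonempty hD.isClosed hD.disjoint hD.isOpen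
      (half_pos hc) le_rfl hA hk₁ hρx hp0 (tsum_edgeAmplitude_ne_top hκ hR hτ hτp hσp) m,
      hx.eLpNorm_bumpSum_eq_top hc (half_pos hc) le_rfl hA hk₁ hk₂ hρx hτ
        (tsum_edgeAmplitude_eq_top hκ (hκ1 hR hx) hR hτ hστ)⟩
  -- The same amplitudes are used with `B` and `ε` adapted to the given decompositions; the
  -- resulting function is not even a member of the refined localization space.
  · rintro W ψ φ₀ hW hψ hφ₀ ⟨M, hM⟩
    obtain ⟨B, ε, hB, hε, hεc, htop⟩ :=
      hD.rlocNorm_bumpSum_eq_top hD.dim_ne_zero hD.nonempty hW hψ hφ₀ hc hC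
    obtain ⟨κ, R, hκ, hR, x, hx⟩ := hfam B (min s 1) hB hr₀
    have hA := edgeAmplitude_nonneg (δ := δ) hκ hR σ τ
    have hmem := hx.memKondratiev_bumpSum hc hC hD.nonempty hD.isClosed hD.disjoint hD.isOpen
      hε hεc hA hk₁ (hcomp hx (min_le_left _ _)) hp0
      (tsum_edgeAmplitude_ne_top hκ hR hτ hτp hσp) m
    exact (hM _ hmem).1.2.ne (htop hx (min_le_right _ _) hA hm hτ
      (tsum_edgeAmplitude_eq_top hκ (hκ1 hR hx) hR hτ hστ))
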